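/- For integers $k\ge 0$, $p_1,\dots,p_k,q\ge 1$ and roots of unity $x_1,\dots,x_k,x\in\mathbb C$ with $(q,x)\ne(1,1)$, put $\zeta_n(p;y)=\sum_{m=1}^{n} y^m/m^p$ and define the cyclotomic Euler sum and the cyclotomic Euler $R$-sum of order $k$ by the (possibly only conditionally) convergent series $$S_{p_1,\dots,p_k;q}(x_1,\dots,x_k;x)=\sum_{n=1}^{\infty}\frac{\zeta_n(p_1;x_1)\cdots\zeta_n(p_k;x_k)}{n^q}\,x^n,\qquad R_{p_1,\dots,p_k;q}(x_1,\dots,x_k;x)=\sum_{n=0}^{\infty}\frac{\zeta_n(p_1;x_1)\cdots\zeta_n(p_k;x_k)}{(n+1/2)^q}\,x^n$$ (an empty product is $1$). Theorem. Let $r\ge 1$, let $x,x_1,\dots,x_r$ be roots of unity and let $p_1,\dots,p_r,q\ge 1$ be integers with $(p_j,x_j)\ne(1,1)$ for $j=1,\dots,r$ and $(q,x)\ne(1,1)$. Then the series defining $R_{p_1,\dots,p_r;q}(x_1,\dots,x_r;x)$ and $R_{p_1,\dots,p_r;q}(x_1^{-1},\dots,x_r^{-1};x^{-1})$ converge, and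 $$x\,R_{p_1,\dots,p_r;q}(x_1,\dots,x_r;x)+(-1)^{p_1+\cdots+p_r+q+r}\,R_{p_1,\dots,p_r;q}(x_1^{-1},\dots,x_r^{-1};x^{-1})$$ is a combination of products of one or more cyclotomic Euler sums and cyclotomic Euler $R$-sums, each of order $<r$ (with arbitrary roots of unity as arguments), with coefficients that are rational up to monomials in the given roots of unity: it is a finite $\mathbb Q$-linear combination of terms $x^{a}x_1^{b_1}\cdots x_r^{b_r}\,P$ with $a,b_1,\dots,b_r\in\mathbb Z$ and $P$ such a product. -/

import Mathlib

open Filter Topology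

noncomputable section

namespace CyclotomicEuler

/-- The finite polylogarithm sum `ζ_n(p; x) = ∑_{k=1}^n x^k / k^p`. -/
def zetaFin (n p : ℕ) (x : ℂ) : ℂ :=
  ∑ k ∈ Finset.Icc 1 n, x ^ k / (k : ℂ) ^ p

/-- Partial sums (terms with `1 ≤ n ≤ N`) of the cyclotomic Euler sum
`S_{p_1,…,p_k;q}(x_1,…,x_k;x)`. -/
def partialS {k : ℕ} (p : Fin k → ℕ) (q : ℕ) (xs : Fin k → ℂ) (x : ℂ) (N : ℕ) : ℂ :=
  ∑ n ∈ Finset.Icc 1 N, (∏ j, zetaFin n (p j) (xs j)) / (n : ℂ) ^ q * x ^ n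

/-- Partial sums (terms with `0 ≤ n < N`) of the cyclotomic Euler `R`-sum
`R_{p_1,…,p_k;q}(x_1,…,x_k;x)`. -/
def partialR {k : ℕ} (p : Fin k → ℕ) (q : ℕ) (xs : Fin k → ℂ) (x : ℂ) (N : ℕ) : ℂ :=
  ∑ n ∈ Finset.range N, (∏ j, zetaFin n (p j) (xs j)) / ((n : ℂ) + 1 / 2) ^ q * x ^ n

/-- The cyclotomic Euler sum
`S_{p_1,…,p_k;q}(x_1,…,x_k;x) = ∑_{n ≥ 1} ζ_n(p_1;x_1)⋯ζ_n(p_k;x_k) x^n / n^q`,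
the limit of its partial sums (for `q = 1` the convergence is only conditional).
For `k = 0` this is the polylogarithm `Li_q(x)`. -/
def eulerS {k : ℕ} (p : Fin k → ℕ) (q : ℕ) (xs : Fin k → ℂ) (x : ℂ) : ℂ :=
  limUnder atTop (partialS p q xs x)

/-- The cyclotomic Euler `R`-sum
`R_{p_1,…,p_k;q}(x_1,…,x_k;x) = ∑_{n ≥ 0} ζ_n(p_1;x_1)⋯ζ_n(p_k;x_k) x^n / (n + 1/2)^q`,
the limit of its partial sums. -/
def eulerR {k : ℕ} (p : Fin k → ℕ) (q : ℕ) (xs : Fin k → ℂ) (x : ℂ) : ℂ :=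
  limUnder atTop (partialR p q xs x)

/-- The index data of a cyclotomic Euler sum or `R`-sum of order `k`: all exponents are positive,
all arguments are roots of unity, and `(q, x) ≠ (1, 1)`. -/
structure Admissible {k : ℕ} (p : Fin k → ℕ) (q : ℕ) (xs : Fin k → ℂ) (x : ℂ) : Prop where
  p_pos : ∀ j, 1 ≤ p j
  q_pos : 1 ≤ q
  xs_root : ∀ j, IsOfFinOrder (xs j)
  x_root : IsOfFinOrder x
  ne_one : (q, x) ≠ (1, 1)

/-- All cyclotomic Euler sums and all cyclotomic Euler `R`-sums of order `< r`. -/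
def lowerSums (r : ℕ) : Set ℂ :=
  {v | ∃ (k : ℕ) (p : Fin k → ℕ) (q : ℕ) (xs : Fin k → ℂ) (x : ℂ),
    k < r ∧ Admissible p q xs x ∧ (v = eulerS p q xs x ∨ v = eulerR p q xs x)}

/-- The monomials `x^a x_1^{b_1} ⋯ x_r^{b_r}` with integer exponents. -/
def rootMonomials {r : ℕ} (xs : Fin r → ℂ) (x : ℂ) : Set ℂ :=
  {u | ∃ (a : ℤ) (b : Fin r → ℤ), u = x ^ a * ∏ j, xs j ^ b j}

/-- Rational linear combinations of terms `u * P`, where `u` is a monomial in the roots of unity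
`x, x_1, …, x_r`, and `P` is a product of one or more cyclotomic Euler sums and
cyclotomic Euler `R`-sums, each of order `< r`. -/
def lowerCombinations {r : ℕ} (xs : Fin r → ℂ) (x : ℂ) : Submodule ℚ ℂ :=
  Submodule.span ℚ
    {v | ∃ u ∈ rootMonomials xs x, ∃ P ∈ Subsemigroup.closure (lowerSums r), v = u * P}

end CyclotomicEuler

end

/-! Write `Z_j = biZeta (p j) (xs j)` for the extension of `ζ_n(p_j; x_j)` to all integers. The
reflection `m ↦ -m - 1` negates `m + 1/2` and turns `Z_j` into `(-1)^(p_j + 1) ζ_n(p_j; x_j⁻¹)`.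
Hence the bilateral sum `B = ∑_m x^m / (m + 1/2)^q ∏_j (Li_{p_j}(x_j) - Z_j(m))`, multiplied by
`(-1)^r x` and expanded, has the two `R`-sums of the theorem, with the right sign, as leading terms;
every other term contains fewer than `r` factors `ζ_n`. It remains to see that `B` is a lower
combination (`limMem_bilateral`).

This is a residue argument made finite. Consider the rational function `K_N(s) = (s + 1/2)^(-q) ∏_j
∑_{k=1}^N x_j^k / (s + k)^(p_j)` and put `y = x ∏_j x_j`. At an integer `m` that is not a pole, `y^m
K_N(m) = x^m / (m + 1/2)^q ∏_j (Z_j(m + N) - Z_j(m))`. At the poles `-N ≤ m < 0` the constant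
Laurent coefficient has this term plus products of fewer than `r` regular parts
(`zpow_mul_coeff_zero_truncKernel`). The same coefficient is given by the partial fractions of `K_N`
(`coeff_zero_truncKernel`). Summed against `y^m` over symmetric ranges, a partial fraction at an
integer `b` gives `y^b c_i` with `c_i` independent of `b` (`exists_bilateral_limit`), and one at
`-1/2` gives an order-zero combination (`limMem_bilateral_half`). The factor `y^b` is what makes the
sum over `b` of the polar coefficients a lower sum, since a negative power needs at least one polar
factor (`coeff_zpow_smul_truncKernel_of_neg`).

Finally `N → ∞` replaces `Z_j(m + N)` by `Li_{p_j}(x_j)`. The error is `O(N^(-1/2))` uniformly in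
the range of summation (`truncation_error_main`), so conditional convergence causes no trouble. -/

noncomputable section

namespace CyclotomicEuler

/-! ### Convergence of sums twisted by a root of unity -/

lemma exists_limit_of_telescoping {s : ℕ → ℂ} {β : ℕ → ℝ}
    (h : ∀ n, ‖s (n + 1) - s n‖ ≤ β n - β (n + 1)) (hβ : Tendsto β atTop (𝓝 0)) :
    ∃ L, ∀ n, ‖s n - L‖ ≤ β n := by
  have anti : Antitone β := antitone_nat_of_succ_le fun n => by
    linarith [norm_nonneg (s (n + 1) - s n), h n]
  have nonneg : ∀ n, 0 ≤ β n := fun n => anti.le_of_tendsto hβ n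
  have key : ∀ n k, ‖s (n + k) - s n‖ ≤ β n - β (n + k) := by
    intro n k
    induction k with
    | zero => simp
    | succ k ih =>
      have := norm_add_le (s (n + k + 1) - s (n + k)) (s (n + k) - s n)
      rw [sub_add_sub_cancel] at this
      have := h (n + k)
      rw [← add_assoc]
      linarith
  have key' : ∀ n m, n ≤ m → ‖s m - s n‖ ≤ β n := by
    intro n m hnm
    obtain ⟨k, rfl⟩ := Nat.exists_eq_add_of_le hnm
    linarith [key n k, nonneg (n + k)]
  have cau : CauchySeq s := by
    refine cauchySeq_of_le_tendsto_0 (fun n => 2 * β n) (fun n m N hn hm => ?_)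
      (by simpa using hβ.const_mul 2)
    have := dist_triangle_right (s n) (s m) (s N)
    rw [dist_eq_norm, dist_eq_norm, dist_eq_norm] at this
    rw [dist_eq_norm]
    linarith [key' N n hn, key' N m hm]
  obtain ⟨L, hL⟩ := cauchySeq_tendsto_of_complete cau
  refine ⟨L, fun n => ?_⟩
  rw [norm_sub_rev]
  refine le_of_tendsto (hL.sub_const (s n)).norm ?_
  filter_upwards [eventually_ge_atTop n] with m hm using key' n m hm

/-- Summation by parts: adding the boundary term `x^n γ_n / (1 - x)` to the partial sum leaves
increments `x^(n+1) (γ_{n+1} - γ_n) / (1 - x)`, whose norms telescope. Removing the boundary term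
again accounts for the factor 2. -/
lemma exists_limit_of_antitone {x : ℂ} (hx : ‖x‖ = 1) (hx1 : x ≠ 1) {γ : ℕ → ℝ}
    (hγ : Antitone γ) (h0 : Tendsto γ atTop (𝓝 0)) :
    ∃ L, ∀ n, ‖∑ k ∈ Finset.range n, x ^ k * γ k - L‖ ≤ 2 / ‖1 - x‖ * γ n := by
  have hne : 1 - x ≠ 0 := sub_ne_zero.mpr hx1.symm
  have hpos : 0 < ‖1 - x‖ := norm_pos_iff.mpr hne
  obtain ⟨L, hL⟩ := exists_limit_of_telescoping
    (s := fun n => ∑ k ∈ Finset.range n, x ^ k * γ k + x ^ n * γ n / (1 - x))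
    (β := fun n => γ n / ‖1 - x‖) (fun n => by
      have : (∑ k ∈ Finset.range (n + 1), x ^ k * γ k + x ^ (n + 1) * γ (n + 1) / (1 - x))
          - (∑ k ∈ Finset.range n, x ^ k * γ k + x ^ n * γ n / (1 - x))
          = x ^ (n + 1) * ((γ (n + 1) - γ n : ℝ) : ℂ) / (1 - x) := by
        rw [Finset.sum_range_succ]
        push_cast
        field_simp
        ring
      rw [this, norm_div, norm_mul, norm_pow, hx, one_pow, one_mul, Complex.norm_real,
        Real.norm_eq_abs, abs_sub_comm, abs_of_nonneg (sub_nonneg.mpr (hγ n.le_succ)), sub_div])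
    (by simpa using h0.div_const ‖1 - x‖)
  refine ⟨L, fun n => ?_⟩
  have e : ∑ k ∈ Finset.range n, x ^ k * (γ k : ℂ) - L
      = (∑ k ∈ Finset.range n, x ^ k * γ k + x ^ n * γ n / (1 - x) - L)
        - x ^ n * γ n / (1 - x) := by ring
  have hn : 0 ≤ γ n := hγ.le_of_tendsto h0 n
  have e2 : ‖x ^ n * (γ n : ℂ) / (1 - x)‖ = γ n / ‖1 - x‖ := by
    rw [norm_div, norm_mul, norm_pow, hx, one_pow, one_mul, Complex.norm_real, Real.norm_eq_abs,
      abs_of_nonneg hn]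
  rw [e]
  refine (norm_sub_le _ _).trans ?_
  rw [e2]
  have := hL n
  calc _ ≤ γ n / ‖1 - x‖ + γ n / ‖1 - x‖ := by gcongr
    _ = _ := by ring

lemma zetaFin_zero (p : ℕ) (x : ℂ) : zetaFin 0 p x = 0 := by simp [zetaFin]

lemma zetaFin_succ (n p : ℕ) (x : ℂ) :
    zetaFin (n + 1) p x = zetaFin n p x + x ^ (n + 1) / ((n : ℂ) + 1) ^ p := by
  rw [zetaFin, Finset.sum_Icc_succ_top (by omega), zetaFin]
  push_cast
  rfl

lemma zetaFin_eq_sum_range (n p : ℕ) (x : ℂ) :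
    zetaFin n p x = x * ∑ k ∈ Finset.range n, x ^ k * (((1 / ((k : ℝ) + 1) ^ p : ℝ)) : ℂ) := by
  induction n with
  | zero => simp [zetaFin_zero]
  | succ n ih =>
    rw [zetaFin_succ, ih, Finset.sum_range_succ]
    push_cast
    ring

lemma zetaFin_rate {p : ℕ} {x : ℂ} (hp : 1 ≤ p) (hx : ‖x‖ = 1) (h : (p, x) ≠ (1, 1)) :
    ∃ L C, 0 ≤ C ∧ ∀ n : ℕ, ‖zetaFin n p x - L‖ ≤ C / ((n : ℝ) + 1) := by
  by_cases hx1 : x = 1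
  · have hp2 : 2 ≤ p := by
      rcases Nat.lt_or_ge 1 p with h1 | h1
      · exact h1
      · exact absurd (by rw [hx1, le_antisymm h1 hp]) h
    obtain ⟨L, hL⟩ := exists_limit_of_telescoping (s := fun n => zetaFin n p x)
      (β := fun n => 2 / ((n : ℝ) + 1)) (fun n => by
        rw [zetaFin_succ, add_sub_cancel_left, norm_div, norm_pow, norm_pow, hx, one_pow]
        have e : ‖(n : ℂ) + 1‖ = (n : ℝ) + 1 := by
          rw [← Nat.cast_succ, Complex.norm_natCast]; push_cast; rfl
        rw [e]
        have h1 : (1 : ℝ) ≤ (n : ℝ) + 1 := by linarith [n.cast_nonneg (α := ℝ)]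
        calc 1 / ((n : ℝ) + 1) ^ p ≤ 1 / ((n : ℝ) + 1) ^ 2 := by
              gcongr
          -- For `a ≥ 1`, `1 / a^2 ≤ 2 / (a (a + 1)) = 2 / a - 2 / (a + 1)`, which telescopes.
          _ ≤ 2 / (((n : ℝ) + 1) * ((n : ℝ) + 1 + 1)) := by
              rw [div_le_div_iff₀ (by positivity) (by positivity)]
              nlinarith
          _ = _ := by
              push_cast
              field_simp
              ring)
      (by
        have := (tendsto_one_div_add_atTop_nhds_zero_nat (𝕜 := ℝ)).const_mul 2
        simpa [div_eq_mul_inv] using this)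
    exact ⟨L, 2, by norm_num, hL⟩
  · obtain ⟨L, hL⟩ := exists_limit_of_antitone hx hx1 (γ := fun k => 1 / ((k : ℝ) + 1) ^ p)
      (fun a b hab => by
        have : (a : ℝ) ≤ b := by exact_mod_cast hab
        dsimp only
        gcongr) (by
        have := (tendsto_one_div_add_atTop_nhds_zero_nat (𝕜 := ℝ)).pow p
        simpa [one_div, inv_pow, show p ≠ 0 by omega] using this)
    refine ⟨x * L, 2 / ‖1 - x‖, by positivity, fun n => ?_⟩
    rw [zetaFin_eq_sum_range, ← mul_sub, norm_mul, hx, one_mul]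
    refine (hL n).trans ?_
    rw [div_eq_mul_one_div (2 / ‖1 - x‖)]
    gcongr
    have h1 : (1 : ℝ) ≤ (n : ℝ) + 1 := by linarith [n.cast_nonneg (α := ℝ)]
    exact le_self_pow₀ h1 (by omega)

/-- The polylogarithm at a point of the unit circle, as a sum of order zero. -/
def polylog (p : ℕ) (x : ℂ) : ℂ := eulerS (k := 0) Fin.elim0 p Fin.elim0 x

lemma tendsto_of_rate {f : ℕ → ℂ} {L : ℂ} {C : ℝ} (h : ∀ n : ℕ, ‖f n - L‖ ≤ C / ((n : ℝ) + 1)) :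
    Tendsto f atTop (𝓝 L) := by
  rw [tendsto_iff_norm_sub_tendsto_zero]
  refine squeeze_zero (fun _ => norm_nonneg _) h ?_
  have := (tendsto_one_div_add_atTop_nhds_zero_nat (𝕜 := ℝ)).const_mul C
  simpa [div_eq_mul_inv] using this

lemma zetaFin_tendsto {p : ℕ} {x : ℂ} (hp : 1 ≤ p) (hx : ‖x‖ = 1) (h : (p, x) ≠ (1, 1)) :
    Tendsto (fun n => zetaFin n p x) atTop (𝓝 (polylog p x)) := by
  obtain ⟨L, C, -, hL⟩ := zetaFin_rate hp hx h
  have e : partialS (k := 0) Fin.elim0 p Fin.elim0 x = fun n => zetaFin n p x := by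
    funext n
    simp only [partialS, zetaFin, Finset.univ_eq_empty, Finset.prod_empty]
    exact Finset.sum_congr rfl fun _ _ => by ring
  rw [polylog, eulerS, e]
  exact tendsto_nhds_limUnder ⟨L, tendsto_of_rate hL⟩

lemma zetaFin_sub_polylog_le {p : ℕ} {x : ℂ} (hp : 1 ≤ p) (hx : ‖x‖ = 1) (h : (p, x) ≠ (1, 1)) :
    ∃ C, 0 ≤ C ∧ ∀ n : ℕ, ‖zetaFin n p x - polylog p x‖ ≤ C / ((n : ℝ) + 1) := by
  obtain ⟨L, C, hC, hL⟩ := zetaFin_rate hp hx h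
  rw [tendsto_nhds_unique (zetaFin_tendsto hp hx h) (tendsto_of_rate hL)]
  exact ⟨C, hC, hL⟩

/-! ### Sums weighted by powers of `n + 1/2` -/

lemma norm_natCast_add_half (n : ℕ) : ‖(n : ℂ) + 1 / 2‖ = (n : ℝ) + 1 / 2 := by
  have : (n : ℂ) + 1 / 2 = (((n : ℝ) + 1 / 2 : ℝ) : ℂ) := by push_cast; rfl
  rw [this, Complex.norm_real, Real.norm_of_nonneg (by positivity)]

lemma tendsto_one_div_natCast_add_half :
    Tendsto (fun n : ℕ => 1 / ((n : ℝ) + 1 / 2)) atTop (𝓝 0) := by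
  simp only [one_div]
  exact (tendsto_natCast_atTop_atTop.atTop_add tendsto_const_nhds).inv_tendsto_atTop

lemma summable_one_div_natCast_add_half_sq :
    Summable fun n : ℕ => 1 / ((n : ℝ) + 1 / 2) ^ 2 := by
  refine Summable.of_nonneg_of_le (fun n => by positivity) (fun n => ?_)
    (((summable_nat_add_iff 1).mpr (Real.summable_one_div_nat_pow.mpr one_lt_two)).mul_left 4)
  push_cast
  rw [mul_one_div, div_le_div_iff₀ (by positivity) (by positivity)]
  nlinarith [n.cast_nonneg (α := ℝ)]

lemma half_le_natCast_pow_le (n q : ℕ) (hq : 1 ≤ q) :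
    1 / ((n : ℝ) + 1 / 2) ^ q ≤ 2 ^ q / ((n : ℝ) + 1 / 2) := by
  obtain ⟨q, rfl⟩ := Nat.exists_eq_add_of_le' hq
  have h1 : (1 : ℝ) ≤ 2 * ((n : ℝ) + 1 / 2) := by linarith [n.cast_nonneg (α := ℝ)]
  have h2 : (1 : ℝ) ≤ 2 ^ q * ((n : ℝ) + 1 / 2) ^ q := by
    rw [← mul_pow]; exact one_le_pow₀ h1
  rw [div_le_div_iff₀ (by positivity) (by positivity), pow_succ, pow_succ]
  have : (0 : ℝ) < (n : ℝ) + 1 / 2 := by positivity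
  nlinarith

lemma halfSum_converges {q : ℕ} {x : ℂ} (hq : 1 ≤ q) (hx : ‖x‖ = 1) (h : (q, x) ≠ (1, 1)) :
    ∃ L, Tendsto (fun N => ∑ n ∈ Finset.range N, x ^ n / ((n : ℂ) + 1 / 2) ^ q) atTop (𝓝 L) := by
  by_cases hx1 : x = 1
  · have hp2 : 2 ≤ q := by
      rcases Nat.lt_or_ge 1 q with h1 | h1
      · exact h1
      · exact absurd (by rw [hx1, le_antisymm h1 hq]) h
    have : Summable fun n : ℕ => x ^ n / ((n : ℂ) + 1 / 2) ^ q := by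
      refine Summable.of_norm_bounded (summable_one_div_natCast_add_half_sq.mul_left (2 ^ q))
        fun n => ?_
      rw [norm_div, norm_pow, norm_pow, hx, one_pow, norm_natCast_add_half]
      obtain ⟨q, rfl⟩ := Nat.exists_eq_add_of_le' hp2
      have h1 : (1 : ℝ) ≤ 2 * ((n : ℝ) + 1 / 2) := by linarith [n.cast_nonneg (α := ℝ)]
      have h2 : (1 : ℝ) ≤ 2 ^ q * ((n : ℝ) + 1 / 2) ^ q := by
        rw [← mul_pow]; exact one_le_pow₀ h1
      rw [mul_one_div, div_le_div_iff₀ (by positivity) (by positivity), pow_add, pow_add]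
      have : (0 : ℝ) < ((n : ℝ) + 1 / 2) ^ 2 := by positivity
      nlinarith
    exact ⟨_, this.hasSum.tendsto_sum_nat⟩
  · obtain ⟨L, hL⟩ := exists_limit_of_antitone hx hx1 (γ := fun k => 1 / ((k : ℝ) + 1 / 2) ^ q)
      (fun a b hab => by
        have : (a : ℝ) ≤ b := by exact_mod_cast hab
        dsimp only
        gcongr) (by
        have := tendsto_one_div_natCast_add_half.pow q
        simpa [one_div, inv_pow, show q ≠ 0 by omega] using this)
    refine ⟨L, ?_⟩
    rw [tendsto_iff_norm_sub_tendsto_zero]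
    have ht := (tendsto_one_div_natCast_add_half.pow q).const_mul (2 / ‖1 - x‖)
    rw [zero_pow (by omega), mul_zero] at ht
    refine squeeze_zero (fun _ => norm_nonneg _) (fun n => ?_) ht
    refine le_trans (le_of_eq ?_) ((hL n).trans (le_of_eq ?_))
    · congr 2
      refine Finset.sum_congr rfl fun k _ => ?_
      push_cast
      ring
    · rw [div_pow, one_pow]

/-- A product of sequences converging at rate `1 / (n + 1)` converges at that rate. -/
lemma prod_rate {ι : Type*} (J : Finset ι) (f : ι → ℕ → ℂ)
    (h : ∀ j ∈ J, ∃ L C, 0 ≤ C ∧ ∀ n : ℕ, ‖f j n - L‖ ≤ C / ((n : ℝ) + 1)) :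
    ∃ L C, 0 ≤ C ∧ ∀ n : ℕ, ‖∏ j ∈ J, f j n - L‖ ≤ C / ((n : ℝ) + 1) := by
  classical
  induction J using Finset.induction_on with
  | empty => exact ⟨1, 0, le_rfl, by simp⟩
  | insert a s ha ih =>
    obtain ⟨L, C, hC, hL⟩ := ih fun j hj => h j (Finset.mem_insert_of_mem hj)
    obtain ⟨L', C', hC', hL'⟩ := h a (Finset.mem_insert_self _ _)
    refine ⟨L' * L, C' * (‖L‖ + C) + ‖L'‖ * C, by positivity, fun n => ?_⟩
    rw [Finset.prod_insert ha]
    set P := ∏ j ∈ s, f j n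
    have e : f a n * P - L' * L = (f a n - L') * P + L' * (P - L) := by ring
    have hP : ‖P‖ ≤ ‖L‖ + C := by
      have h1 := norm_sub_norm_le P L
      have h2 : C / ((n : ℝ) + 1) ≤ C := div_le_self hC (by linarith [n.cast_nonneg (α := ℝ)])
      linarith [hL n]
    rw [e]
    refine (norm_add_le _ _).trans ?_
    rw [norm_mul, norm_mul, add_div, mul_div_right_comm, mul_div_assoc ‖L'‖]
    gcongr
    · exact hL' n
    · exact hL n

/-- Split `a n = L + (a n - L)`: the constant part converges, perhaps conditionally, by
`halfSum_converges`; the remainder is `O(n^(-2))` and converges absolutely. -/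
lemma weightedHalfSum_converges {q : ℕ} {x : ℂ} (hq : 1 ≤ q) (hx : ‖x‖ = 1)
    (h : (q, x) ≠ (1, 1)) {a : ℕ → ℂ} {L : ℂ} {C : ℝ}
    (ha : ∀ n : ℕ, ‖a n - L‖ ≤ C / ((n : ℝ) + 1)) (hC : 0 ≤ C) :
    ∃ S, Tendsto (fun N => ∑ n ∈ Finset.range N, a n / ((n : ℂ) + 1 / 2) ^ q * x ^ n)
      atTop (𝓝 S) := by
  obtain ⟨S, hS⟩ := halfSum_converges hq hx h
  have hs : Summable fun n : ℕ => (a n - L) / ((n : ℂ) + 1 / 2) ^ q * x ^ n := by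
    refine Summable.of_norm_bounded
      (summable_one_div_natCast_add_half_sq.mul_left (C * 2 ^ q)) fun n => ?_
    rw [norm_mul, norm_div, norm_pow, norm_pow, hx, one_pow, mul_one, norm_natCast_add_half]
    have h1 := half_le_natCast_pow_le n q hq
    have h2 : C / ((n : ℝ) + 1) ≤ C / ((n : ℝ) + 1 / 2) := by gcongr; norm_num
    calc _ = ‖a n - L‖ * (1 / ((n : ℝ) + 1 / 2) ^ q) := by ring
      _ ≤ C / ((n : ℝ) + 1 / 2) * (2 ^ q / ((n : ℝ) + 1 / 2)) := by
        gcongr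
        exact (ha n).trans h2
      _ = _ := by rw [div_mul_div_comm, ← pow_two, mul_one_div]
  refine ⟨_, (hs.hasSum.tendsto_sum_nat.add (hS.const_mul L)).congr fun N => ?_⟩
  rw [Finset.mul_sum, ← Finset.sum_add_distrib]
  exact Finset.sum_congr rfl fun n _ => by ring

lemma halfEuler_converges {ι : Type*} (J : Finset ι) {p : ι → ℕ} {q : ℕ} {xs : ι → ℂ} {x : ℂ}
    (hp : ∀ j ∈ J, 1 ≤ p j) (hq : 1 ≤ q) (hxs : ∀ j ∈ J, ‖xs j‖ = 1) (hx : ‖x‖ = 1)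
    (hpx : ∀ j ∈ J, (p j, xs j) ≠ (1, 1)) (h : (q, x) ≠ (1, 1)) :
    ∃ S, Tendsto (fun N => ∑ n ∈ Finset.range N,
      (∏ j ∈ J, zetaFin n (p j) (xs j)) / ((n : ℂ) + 1 / 2) ^ q * x ^ n) atTop (𝓝 S) := by
  obtain ⟨L, C, hC, hL⟩ := prod_rate J (fun j n => zetaFin n (p j) (xs j))
    fun j hj => zetaFin_rate (hp j hj) (hxs j hj) (hpx j hj)
  exact weightedHalfSum_converges hq hx h hL hC

/-! ### Bilateral finite polylogarithms -/

/-- The extension of `n ↦ ζ_n(p; x)` to all integers whose increments are `x ^ m / m ^ p`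
(and `0` at `m = 0`). -/
def biZeta (p : ℕ) (x : ℂ) : ℤ → ℂ
  | Int.ofNat n => zetaFin n p x
  | Int.negSucc n => (-1) ^ (p + 1) * zetaFin n p x⁻¹

lemma biZeta_natCast (p : ℕ) (x : ℂ) (n : ℕ) : biZeta p x (n : ℤ) = zetaFin n p x := rfl

lemma biZeta_negSucc (p : ℕ) (x : ℂ) (n : ℕ) :
    biZeta p x (Int.negSucc n) = (-1) ^ (p + 1) * zetaFin n p x⁻¹ := rfl

lemma biZeta_add_one {p : ℕ} (hp : 1 ≤ p) (x : ℂ) (m : ℤ) :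
    biZeta p x (m + 1) = biZeta p x m + x ^ (m + 1) / ((m + 1 : ℤ) : ℂ) ^ p := by
  rcases m with n | n
  · have : Int.ofNat n + 1 = ((n + 1 : ℕ) : ℤ) := by simp
    rw [this, biZeta_natCast, zetaFin_succ, Int.ofNat_eq_natCast, biZeta_natCast, zpow_natCast]
    push_cast
    rfl
  · rcases n with _ | n
    · have : Int.negSucc 0 + 1 = ((0 : ℕ) : ℤ) := by simp
      rw [this, biZeta_natCast, biZeta_negSucc, zetaFin_zero, zetaFin_zero]
      -- The increment at index `0` is `1 / 0^p`, which is `0` by convention because `p ≠ 0`.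
      simp [show p ≠ 0 by omega]
    · have : Int.negSucc (n + 1) + 1 = Int.negSucc n := by omega
      rw [this, biZeta_negSucc, biZeta_negSucc, zetaFin_succ, zpow_negSucc]
      have e : ((Int.negSucc n : ℤ) : ℂ) = -((n : ℂ) + 1) := by
        rw [Int.cast_negSucc]; push_cast; rfl
      have h2 : ((-1 : ℂ) ^ p)⁻¹ = (-1) ^ p := by rw [← inv_pow]; norm_num
      rw [e, neg_pow ((n : ℂ) + 1), div_eq_mul_inv _ ((-1) ^ p * _), mul_inv, h2]
      ring

/-- When the range crosses zero, the term with `m + k + 1 = 0` has the default value `0`; the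
formula therefore computes exactly the nonsingular part of the sum, as needed at a pole of the
kernel. -/
lemma sum_range_zpow_div {p : ℕ} (hp : 1 ≤ p) (x : ℂ) (m : ℤ) (N : ℕ) :
    ∑ k ∈ Finset.range N, x ^ (m + k + 1) / ((m + k + 1 : ℤ) : ℂ) ^ p
      = biZeta p x (m + N) - biZeta p x m := by
  induction N with
  | zero => simp
  | succ N ih =>
    rw [Finset.sum_range_succ, ih, Nat.cast_succ, ← add_assoc, biZeta_add_one hp]
    ring

/-- The sum of `F m` over `-M ≤ m < M`. -/
def biSum (F : ℤ → ℂ) (M : ℕ) : ℂ :=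
  ∑ n ∈ Finset.range M, (F (n : ℤ) + F (Int.negSucc n))

lemma biSum_succ (F : ℤ → ℂ) (M : ℕ) :
    biSum F (M + 1) = biSum F M + (F (M : ℤ) + F (Int.negSucc M)) :=
  Finset.sum_range_succ _ _

lemma biSum_eq_sum_Ico (F : ℤ → ℂ) (M : ℕ) :
    biSum F M = ∑ m ∈ Finset.Ico (-(M : ℤ)) M, F m := by
  induction M with
  | zero => simp [biSum]
  | succ M ih =>
    have e : Finset.Ico (-((M + 1 : ℕ) : ℤ)) ((M + 1 : ℕ) : ℤ)
        = insert (M : ℤ) (insert (Int.negSucc M) (Finset.Ico (-(M : ℤ)) M)) := by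
      ext m
      simp only [Finset.mem_Ico, Finset.mem_insert]
      omega
    rw [biSum_succ, ih, e, Finset.sum_insert, Finset.sum_insert]
    · ring
    · simp only [Finset.mem_Ico]; omega
    · simp only [Finset.mem_Ico, Finset.mem_insert]; omega

/-- Translation by `b` extracts `y^b` and only moves the window of summation; the term `m = b` is
`0` by convention. -/
lemma biSum_zpow_div {i : ℕ} (hi : 1 ≤ i) {y : ℂ} (hy : y ≠ 0) (b : ℤ) (M : ℕ) :
    biSum (fun m => y ^ m / ((m : ℂ) - b) ^ i) M
      = y ^ b * (biZeta i y (M - 1 - b) - biZeta i y (-M - 1 - b)) := by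
  induction M with
  | zero => simp [biSum]
  | succ M ih =>
    have h1 := biZeta_add_one hi y (M - 1 - b)
    have h2 := biZeta_add_one hi y (-(M + 1 : ℕ) - 1 - b)
    rw [show ((M : ℤ) - 1 - b + 1) = M - b by ring] at h1
    rw [show (-((M + 1 : ℕ) : ℤ) - 1 - b + 1) = -M - 1 - b by push_cast; ring] at h2
    rw [biSum_succ, ih, show (((M + 1 : ℕ) : ℤ) - 1 - b) = M - b by push_cast; ring, h1, h2,
      show Int.negSucc M = -(M : ℤ) - 1 by omega, show (M : ℤ) = (M - b) + b by ring,
      zpow_add₀ hy, show -((M : ℤ) - b + b) - 1 = (-M - 1 - b) + b by ring, zpow_add₀ hy]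
    push_cast
    ring_nf

/-- The distance `|m + 1/2|`. -/
def halfDist (m : ℤ) : ℝ := |(m : ℝ) + 1 / 2|

lemma half_le_halfDist (m : ℤ) : 1 / 2 ≤ halfDist m := by
  rcases le_or_gt 0 m with h | h
  · have : (0 : ℝ) ≤ m := by exact_mod_cast h
    rw [halfDist, abs_of_nonneg (by linarith)]
    linarith
  · have : (m : ℝ) ≤ -1 := by exact_mod_cast Int.le_sub_one_of_lt h
    rw [halfDist, abs_of_neg (by linarith)]
    linarith

lemma halfDist_pos (m : ℤ) : 0 < halfDist m := by linarith [half_le_halfDist m]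

lemma norm_intCast_add_half (m : ℤ) : ‖(m : ℂ) + 1 / 2‖ = halfDist m := by
  have : (m : ℂ) + 1 / 2 = (((m : ℝ) + 1 / 2 : ℝ) : ℂ) := by push_cast; rfl
  rw [this, Complex.norm_real, Real.norm_eq_abs, halfDist]

lemma intCast_add_half_ne_zero (m : ℤ) : (m : ℂ) + 1 / 2 ≠ 0 := by
  rw [← norm_pos_iff, norm_intCast_add_half]; exact halfDist_pos m

lemma inv_ne_pair {p : ℕ} {x : ℂ} (h : (p, x) ≠ (1, 1)) : (p, x⁻¹) ≠ (1, 1) := by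
  simpa [Prod.ext_iff] using h

lemma biZeta_right {p : ℕ} {x : ℂ} (hp : 1 ≤ p) (hx : ‖x‖ = 1) (h : (p, x) ≠ (1, 1)) :
    ∃ C, 0 ≤ C ∧ ∀ m : ℤ, 0 ≤ m → ‖biZeta p x m - polylog p x‖ ≤ C / halfDist m := by
  obtain ⟨C, hC, hL⟩ := zetaFin_sub_polylog_le hp hx h
  refine ⟨C, hC, fun m hm => ?_⟩
  obtain ⟨n, rfl⟩ := Int.eq_ofNat_of_zero_le hm
  rw [biZeta_natCast, halfDist, Int.cast_natCast, abs_of_nonneg (by positivity)]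
  refine (hL n).trans ?_
  gcongr
  norm_num

lemma biZeta_left {p : ℕ} {x : ℂ} (hp : 1 ≤ p) (hx : ‖x‖ = 1) (h : (p, x) ≠ (1, 1)) :
    ∃ C, 0 ≤ C ∧ ∀ m : ℤ, m < 0 →
      ‖biZeta p x m - (-1) ^ (p + 1) * polylog p x⁻¹‖ ≤ C / halfDist m := by
  obtain ⟨C, hC, hL⟩ := zetaFin_sub_polylog_le (x := x⁻¹) hp (by simp [hx]) (inv_ne_pair h)
  refine ⟨C, hC, fun m hm => ?_⟩
  obtain ⟨n, rfl⟩ := Int.eq_negSucc_of_lt_zero hm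
  have e : halfDist (Int.negSucc n) = (n : ℝ) + 1 / 2 := by
    rw [halfDist, Int.cast_negSucc, abs_of_neg (by push_cast; linarith [n.cast_nonneg (α := ℝ)])]
    push_cast
    ring
  rw [biZeta_negSucc, ← mul_sub, norm_mul, norm_pow, norm_neg, norm_one, one_pow, one_mul, e]
  refine (hL n).trans ?_
  gcongr
  norm_num

lemma biZeta_bounded {p : ℕ} {x : ℂ} (hp : 1 ≤ p) (hx : ‖x‖ = 1) (h : (p, x) ≠ (1, 1)) :
    ∃ C, 0 ≤ C ∧ ∀ m : ℤ, ‖biZeta p x m‖ ≤ C := by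
  obtain ⟨C, hC, hr⟩ := biZeta_right hp hx h
  obtain ⟨C', hC', hl⟩ := biZeta_left hp hx h
  have key : ∀ (c : ℝ) (m : ℤ), 0 ≤ c → c / halfDist m ≤ 2 * c := fun c m hc => by
    rw [div_le_iff₀ (halfDist_pos m)]
    nlinarith [half_le_halfDist m]
  set a := ‖polylog p x‖
  set b := ‖(-1) ^ (p + 1) * polylog p x⁻¹‖
  refine ⟨2 * C + a + (2 * C' + b), by positivity, fun m => ?_⟩
  have ha : 0 ≤ a := norm_nonneg _
  have hb : 0 ≤ b := norm_nonneg _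
  rcases le_or_gt 0 m with hm | hm
  · have h1 := hr m hm
    have h2 := norm_le_norm_add_norm_sub' (biZeta p x m) (polylog p x)
    linarith [key C m hC]
  · have h1 := hl m hm
    have h2 := norm_le_norm_add_norm_sub' (biZeta p x m) ((-1) ^ (p + 1) * polylog p x⁻¹)
    linarith [key C' m hC']

/-! ### Error estimates for the truncation -/

/-- With `u = √a` and `v = √b` one has `√N ≤ u + v` and `(u + v) u v ≤ u^3 + v^3`. This trades the
product of two distances for summable powers with exponent `3/2`, at a gain of `N^(-1/2)`. -/
lemma one_div_mul_le {N a b : ℝ} (hN : 0 < N) (ha : 0 < a) (hb : 0 < b) (h : N ≤ a + b) :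
    1 / (a * b) ≤ 1 / √N * (1 / a ^ (3 / 2 : ℝ) + 1 / b ^ (3 / 2 : ℝ)) := by
  have e : ∀ c : ℝ, 0 < c → c ^ (3 / 2 : ℝ) = √c ^ 3 := fun c hc => by
    rw [Real.sqrt_eq_rpow, ← Real.rpow_natCast, ← Real.rpow_mul hc.le]
    norm_num
  rw [e a ha, e b hb]
  have hu : 0 < √a := Real.sqrt_pos.mpr ha
  have hv : 0 < √b := Real.sqrt_pos.mpr hb
  have hw : 0 < √N := Real.sqrt_pos.mpr hN
  have hua : √a ^ 2 = a := Real.sq_sqrt ha.le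
  have hvb : √b ^ 2 = b := Real.sq_sqrt hb.le
  have hwN : √N ^ 2 = N := Real.sq_sqrt hN.le
  set u := √a
  set v := √b
  set w := √N
  have hle : w ≤ u + v := by
    have : w ^ 2 ≤ (u + v) ^ 2 := by nlinarith [mul_pos hu hv]
    exact le_of_sq_le_sq this (by positivity)
  have key : w * (u * v) ≤ u ^ 3 + v ^ 3 := by
    have h1 : w * (u * v) ≤ (u + v) * (u * v) := by gcongr
    nlinarith [mul_nonneg (add_pos hu hv).le (sq_nonneg (u - v))]
  rw [← hua, ← hvb]
  have : 1 / w * (1 / u ^ 3 + 1 / v ^ 3) = (u ^ 3 + v ^ 3) / (w * (u ^ 3 * v ^ 3)) := by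
    field_simp
    ring
  rw [this, div_le_div_iff₀ (by positivity) (by positivity)]
  have : 0 < u ^ 2 * v ^ 2 := by positivity
  nlinarith [mul_le_mul_of_nonneg_left key this.le]

lemma sum_one_div_halfDist_le :
    ∃ K, 0 ≤ K ∧ ∀ N : ℕ, 1 ≤ N → ∀ s : Finset ℤ,
      ∑ m ∈ s, 1 / (halfDist m * halfDist (m + N)) ≤ K / √N := by
  have hs : Summable fun m : ℤ => 1 / halfDist m ^ (3 / 2 : ℝ) :=
    (Real.summable_one_div_int_add_rpow (1 / 2) (3 / 2)).mpr (by norm_num)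
  have nn : ∀ m : ℤ, 0 ≤ 1 / halfDist m ^ (3 / 2 : ℝ) := fun m => by
    have := halfDist_pos m
    positivity
  set S := ∑' m : ℤ, 1 / halfDist m ^ (3 / 2 : ℝ)
  refine ⟨2 * S, by have : 0 ≤ S := tsum_nonneg nn
                    positivity, fun N hN s => ?_⟩
  have hN' : (0 : ℝ) < N := by exact_mod_cast hN
  calc ∑ m ∈ s, 1 / (halfDist m * halfDist (m + N))
      ≤ ∑ m ∈ s, 1 / √N * (1 / halfDist m ^ (3 / 2 : ℝ) + 1 / halfDist (m + N) ^ (3 / 2 : ℝ)) := by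
        refine Finset.sum_le_sum fun m _ => ?_
        refine one_div_mul_le hN' (halfDist_pos _) (halfDist_pos _) ?_
        have := abs_sub_abs_le_abs_sub ((m : ℝ) + N + 1 / 2) (m + 1 / 2)
        have h2 := abs_sub ((m : ℝ) + N + 1 / 2) (m + 1 / 2)
        rw [show (m : ℝ) + N + 1 / 2 - (m + 1 / 2) = N by ring, abs_of_pos hN'] at h2
        simp only [halfDist]
        push_cast
        linarith
    _ = 1 / √N * (∑ m ∈ s, 1 / halfDist m ^ (3 / 2 : ℝ)
          + ∑ m ∈ s.map (Equiv.addRight (N : ℤ)).toEmbedding, 1 / halfDist m ^ (3 / 2 : ℝ)) := by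
        rw [Finset.sum_map, ← Finset.sum_add_distrib, Finset.mul_sum]
        rfl
    _ ≤ 1 / √N * (S + S) := by
        gcongr
        · exact hs.sum_le_tsum _ fun m _ => nn m
        · exact hs.sum_le_tsum _ fun m _ => nn m
    _ = _ := by ring

open Asymptotics

/-- The reciprocal distance of a shifted index, the size of a truncation error. -/
def shiftErr (i : ℤ × ℕ) : ℝ := 1 / halfDist (i.1 + i.2)

lemma isBigO_shiftErr_iff {f : ℤ × ℕ → ℂ} {s : Set (ℤ × ℕ)} :
    f =O[𝓟 s] shiftErr ↔ ∃ c, ∀ i ∈ s, ‖f i‖ ≤ c / halfDist (i.1 + i.2) := by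
  rw [isBigO_principal]
  have : ∀ i, ‖shiftErr i‖ = 1 / halfDist (i.1 + i.2) := fun i => by
    rw [shiftErr, Real.norm_of_nonneg (by have := halfDist_pos (i.1 + i.2); positivity)]
  simp only [this, mul_one_div]

/-- The factors are exchanged one at a time: `f P - g Q = (f - g) P + g (P - Q)` with bounded `P`
and `g`. -/
lemma prod_sub_prod_isBigO {α ι : Type*} {l : Filter α} (J : Finset ι) {f g : ι → α → ℂ}
    {e : α → ℝ} (hf : ∀ j ∈ J, f j =O[l] fun _ => (1 : ℝ))
    (hg : ∀ j ∈ J, g j =O[l] fun _ => (1 : ℝ))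
    (h : ∀ j ∈ J, (fun i => f j i - g j i) =O[l] e) :
    (fun i => ∏ j ∈ J, f j i - ∏ j ∈ J, g j i) =O[l] e := by
  classical
  induction J using Finset.induction_on with
  | empty => simpa using isBigO_zero e l
  | insert a s ha ih =>
    have ih' := ih (fun j hj => hf j (Finset.mem_insert_of_mem hj))
      (fun j hj => hg j (Finset.mem_insert_of_mem hj))
      (fun j hj => h j (Finset.mem_insert_of_mem hj))
    have hp : (fun i => ∏ j ∈ s, f j i) =O[l] fun _ => (1 : ℝ) := by
      simpa using IsBigO.finsetProd (s := s) (f := f) (g := fun _ _ => (1 : ℝ))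
        fun j hj => hf j (Finset.mem_insert_of_mem hj)
    have h1 := (h a (Finset.mem_insert_self _ _)).mul hp
    have h2 := (hg a (Finset.mem_insert_self _ _)).mul ih'
    simp only [mul_one, one_mul] at h1 h2
    refine (h1.add h2).congr_left fun i => ?_
    rw [Finset.prod_insert ha, Finset.prod_insert ha]
    ring

section Truncation

variable {p : ℕ} {x : ℂ}

lemma biZeta_diff_isBigO_one (hp : 1 ≤ p) (hx : ‖x‖ = 1) (h : (p, x) ≠ (1, 1))
    (l : Filter (ℤ × ℕ)) :
    (fun i : ℤ × ℕ => biZeta p x (i.1 + i.2) - biZeta p x i.1) =O[l] fun _ => (1 : ℝ) := by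
  obtain ⟨C, -, hb⟩ := biZeta_bounded hp hx h
  refine IsBigO.of_bound (2 * C) (Eventually.of_forall fun i => ?_)
  refine (norm_sub_le _ _).trans ?_
  rw [norm_one]
  linarith [hb (i.1 + i.2), hb i.1]

lemma polylog_sub_biZeta_isBigO_one (hp : 1 ≤ p) (hx : ‖x‖ = 1) (h : (p, x) ≠ (1, 1))
    (l : Filter (ℤ × ℕ)) :
    (fun i : ℤ × ℕ => polylog p x - biZeta p x i.1) =O[l] fun _ => (1 : ℝ) := by
  obtain ⟨C, -, hb⟩ := biZeta_bounded hp hx h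
  refine IsBigO.of_bound (‖polylog p x‖ + C) (Eventually.of_forall fun i => ?_)
  refine (norm_sub_le _ _).trans ?_
  rw [norm_one]
  linarith [hb i.1]

lemma biZeta_near (hp : 1 ≤ p) (hx : ‖x‖ = 1) (h : (p, x) ≠ (1, 1)) :
    (fun i : ℤ × ℕ => biZeta p x (i.1 + i.2) - biZeta p x i.1 - (polylog p x - biZeta p x i.1))
      =O[𝓟 {i : ℤ × ℕ | 0 ≤ i.1 + i.2}] shiftErr := by
  obtain ⟨C, -, hr⟩ := biZeta_right hp hx h
  refine isBigO_shiftErr_iff.mpr ⟨C, fun i hi => ?_⟩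
  rw [sub_sub_sub_cancel_right]
  exact hr _ hi

/-- Here `m` and `m + N` lie on the same side of zero, so both values are close to the same end
value of `biZeta`. The error at `m` is absorbed because `|m + N + 1/2|` is at most `|m + 1/2|` on
the left and at most `2 |m + 1/2|` on the right. -/
lemma biZeta_far (hp : 1 ≤ p) (hx : ‖x‖ = 1) (h : (p, x) ≠ (1, 1)) :
    (fun i : ℤ × ℕ => biZeta p x (i.1 + i.2) - biZeta p x i.1)
      =O[𝓟 {i : ℤ × ℕ | i.1 + i.2 < 0 ∨ (i.2 : ℤ) ≤ i.1}] shiftErr := by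
  obtain ⟨C, hC, hr⟩ := biZeta_right hp hx h
  obtain ⟨C', hC', hl⟩ := biZeta_left hp hx h
  refine isBigO_shiftErr_iff.mpr ⟨3 * C + 2 * C', fun i hi => ?_⟩
  obtain ⟨m, N⟩ := i
  change m + N < 0 ∨ (N : ℤ) ≤ m at hi
  change _ ≤ _ / halfDist (m + N)
  have hd := halfDist_pos (m + N)
  have hd' := halfDist_pos m
  have key : ∀ L : ℂ, biZeta p x (m + N) - biZeta p x m
      = (biZeta p x (m + N) - L) - (biZeta p x m - L) := fun L => by ring
  rcases hi with hi | hi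
  · have hm : m < 0 := by omega
    have hle : halfDist (m + N) ≤ halfDist m := by
      have h1 : ((m : ℝ) + N) ≤ -1 := by exact_mod_cast Int.le_sub_one_of_lt hi
      have h2 : (0 : ℝ) ≤ N := N.cast_nonneg
      simp only [halfDist]
      push_cast
      rw [abs_of_neg (by linarith), abs_of_neg (by linarith)]
      linarith
    have h3 : C' / halfDist m ≤ C' / halfDist (m + N) := by gcongr
    have h4 : 0 ≤ C / halfDist (m + N) := by positivity
    rw [key ((-1) ^ (p + 1) * polylog p x⁻¹)]
    refine (norm_sub_le _ _).trans ?_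
    have h5 := hl _ hi
    have h6 := hl _ hm
    rw [add_div, mul_div_assoc, mul_div_assoc]
    linarith
  · have hm : 0 ≤ m := by omega
    have hle : halfDist (m + N) ≤ 2 * halfDist m := by
      have h1 : (N : ℝ) ≤ m := by exact_mod_cast hi
      have h2 : (0 : ℝ) ≤ N := N.cast_nonneg
      simp only [halfDist]
      push_cast
      rw [abs_of_nonneg (by linarith), abs_of_nonneg (by linarith)]
      linarith
    have h3 : C / halfDist m ≤ 2 * (C / halfDist (m + N)) := by
      rw [← mul_div_assoc, div_le_div_iff₀ hd' hd]
      nlinarith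
    have h4 : 0 ≤ C' / halfDist (m + N) := by positivity
    rw [key (polylog p x)]
    refine (norm_sub_le _ _).trans ?_
    have h5 := hr (m + N) (by omega)
    have h6 := hr _ hm
    rw [add_div, mul_div_assoc, mul_div_assoc]
    linarith

end Truncation

lemma norm_zpow_div_le {x : ℂ} (hx : ‖x‖ = 1) {q : ℕ} (hq : 1 ≤ q) (m : ℤ) :
    ‖x ^ m / ((m : ℂ) + 1 / 2) ^ q‖ ≤ 2 ^ q / halfDist m := by
  rw [norm_div, norm_zpow, hx, one_zpow, norm_pow, norm_intCast_add_half]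
  obtain ⟨q, rfl⟩ := Nat.exists_eq_add_of_le' hq
  have h0 := halfDist_pos m
  have h1 : (1 : ℝ) ≤ 2 * halfDist m := by linarith [half_le_halfDist m]
  have h2 : (1 : ℝ) ≤ 2 ^ q * halfDist m ^ q := by
    rw [← mul_pow]; exact one_le_pow₀ h1
  rw [div_le_div_iff₀ (by positivity) (by positivity), pow_succ, pow_succ]
  nlinarith

lemma sum_weighted_le {x : ℂ} (hx : ‖x‖ = 1) {q : ℕ} (hq : 1 ≤ q) {f : ℤ × ℕ → ℂ}
    {s : Set (ℤ × ℕ)} (hf : f =O[𝓟 s] shiftErr) :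
    ∃ K, ∀ N : ℕ, 1 ≤ N → ∀ t : Finset ℤ, (∀ m ∈ t, (m, N) ∈ s) →
      ‖∑ m ∈ t, x ^ m / ((m : ℂ) + 1 / 2) ^ q * f (m, N)‖ ≤ K / √N := by
  obtain ⟨c, hc⟩ := isBigO_shiftErr_iff.mp hf
  obtain ⟨K, hK, hle⟩ := sum_one_div_halfDist_le
  refine ⟨2 ^ q * |c| * K, fun N hN t ht => ?_⟩
  calc _ ≤ ∑ m ∈ t, 2 ^ q * |c| * (1 / (halfDist m * halfDist (m + N))) := by
        refine norm_sum_le_of_le _ fun m hm => ?_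
        have h0 := halfDist_pos m
        have h1 := halfDist_pos (m + N)
        rw [norm_mul]
        have h2 : ‖f (m, N)‖ ≤ |c| / halfDist (m + N) := (hc _ (ht m hm)).trans (by
          gcongr
          exact le_abs_self c)
        calc _ ≤ 2 ^ q / halfDist m * (|c| / halfDist (m + N)) := by
              gcongr
              exact norm_zpow_div_le hx hq m
          _ = _ := by field_simp
    _ ≤ 2 ^ q * |c| * (K / √N) := by
        rw [← Finset.mul_sum]
        gcongr
        exact hle N hN t
    _ = _ := by ring

section Product

variable {ι : Type*} (J : Finset ι) {p : ι → ℕ} {q : ℕ} {xs : ι → ℂ} {x : ℂ}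

lemma truncation_error_neg (hp : ∀ j ∈ J, 1 ≤ p j) (hq : 1 ≤ q) (hxs : ∀ j ∈ J, ‖xs j‖ = 1)
    (hx : ‖x‖ = 1) (hpx : ∀ j ∈ J, (p j, xs j) ≠ (1, 1)) :
    Tendsto (fun N : ℕ => ∑ n ∈ Finset.range N,
      x ^ (Int.negSucc n) / (((Int.negSucc n : ℤ) : ℂ) + 1 / 2) ^ q *
        (∏ j ∈ J, (biZeta (p j) (xs j) (Int.negSucc n + N) - biZeta (p j) (xs j) (Int.negSucc n))
          - ∏ j ∈ J, (polylog (p j) (xs j) - biZeta (p j) (xs j) (Int.negSucc n))))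
      atTop (𝓝 0) := by
  have h := prod_sub_prod_isBigO J
    (fun j hj => biZeta_diff_isBigO_one (hp j hj) (hxs j hj) (hpx j hj) (𝓟 {i : ℤ × ℕ | 0 ≤ i.1 + i.2}))
    (fun j hj => polylog_sub_biZeta_isBigO_one (hp j hj) (hxs j hj) (hpx j hj) _)
    (fun j hj => biZeta_near (hp j hj) (hxs j hj) (hpx j hj))
  obtain ⟨K, hK⟩ := sum_weighted_le hx hq h
  have ht : Tendsto (fun N : ℕ => K / √(N : ℝ)) atTop (𝓝 0) :=
    (Real.tendsto_sqrt_atTop.comp tendsto_natCast_atTop_atTop).const_div_atTop K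
  refine squeeze_zero_norm' ?_ ht
  filter_upwards [eventually_ge_atTop 1] with N hN
  have := hK N hN ((Finset.range N).map ⟨Int.negSucc, fun a b h => by omega⟩) (by
    intro m hm
    simp only [Finset.mem_map, Finset.mem_range] at hm
    obtain ⟨n, hn, rfl⟩ := hm
    change 0 ≤ Int.negSucc n + (N : ℤ)
    omega)
  rwa [Finset.sum_map] at this

/-- On `-N ≤ m < N` each `biZeta` value at `m + N` is replaced by its limit. Outside, the whole
product is small: one factor decays by `biZeta_far` and the others are bounded, which is where `J`
must be nonempty. The bound is independent of `M`, so `M → ∞` may be taken first. -/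
lemma truncation_error_main (hJ : J.Nonempty) (hp : ∀ j ∈ J, 1 ≤ p j) (hq : 1 ≤ q)
    (hxs : ∀ j ∈ J, ‖xs j‖ = 1) (hx : ‖x‖ = 1) (hpx : ∀ j ∈ J, (p j, xs j) ≠ (1, 1)) :
    ∃ K, ∀ N : ℕ, 1 ≤ N → ∀ M : ℕ, N ≤ M →
      ‖biSum (fun m => x ^ m / ((m : ℂ) + 1 / 2) ^ q *
          ∏ j ∈ J, (biZeta (p j) (xs j) (m + N) - biZeta (p j) (xs j) m)) M
        - biSum (fun m => x ^ m / ((m : ℂ) + 1 / 2) ^ q *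
          ∏ j ∈ J, (polylog (p j) (xs j) - biZeta (p j) (xs j) m)) N‖ ≤ K / √N := by
  classical
  have h := prod_sub_prod_isBigO J
    (fun j hj => biZeta_diff_isBigO_one (hp j hj) (hxs j hj) (hpx j hj) (𝓟 {i : ℤ × ℕ | 0 ≤ i.1 + i.2}))
    (fun j hj => polylog_sub_biZeta_isBigO_one (hp j hj) (hxs j hj) (hpx j hj) _)
    (fun j hj => biZeta_near (hp j hj) (hxs j hj) (hpx j hj))
  have h' : (fun i : ℤ × ℕ => ∏ j ∈ J, (biZeta (p j) (xs j) (i.1 + i.2) - biZeta (p j) (xs j) i.1))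
      =O[𝓟 {i : ℤ × ℕ | i.1 + i.2 < 0 ∨ (i.2 : ℤ) ≤ i.1}] shiftErr := by
    obtain ⟨a, ha⟩ := hJ
    have h1 := biZeta_far (hp a ha) (hxs a ha) (hpx a ha)
    have h2 := IsBigO.finsetProd (s := J.erase a)
      (f := fun j (i : ℤ × ℕ) => biZeta (p j) (xs j) (i.1 + i.2) - biZeta (p j) (xs j) i.1)
      (g := fun _ _ => (1 : ℝ)) (l := 𝓟 {i : ℤ × ℕ | i.1 + i.2 < 0 ∨ (i.2 : ℤ) ≤ i.1})
      fun j hj => have hj := Finset.mem_of_mem_erase hj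
        biZeta_diff_isBigO_one (hp j hj) (hxs j hj) (hpx j hj) _
    have h3 := h1.mul h2
    simp only [Finset.prod_const_one, mul_one] at h3
    exact h3.congr_left fun i => Finset.mul_prod_erase J
      (fun j => biZeta (p j) (xs j) (i.1 + i.2) - biZeta (p j) (xs j) i.1) ha
  obtain ⟨K, hK⟩ := sum_weighted_le hx hq h
  obtain ⟨K', hK'⟩ := sum_weighted_le hx hq h'
  refine ⟨K + K', fun N hN M hM => ?_⟩
  have hsub : Finset.Ico (-(N : ℤ)) N ⊆ Finset.Ico (-(M : ℤ)) M :=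
    Finset.Ico_subset_Ico (by omega) (by omega)
  rw [biSum_eq_sum_Ico, biSum_eq_sum_Ico, ← Finset.sum_sdiff hsub, add_sub_assoc,
    ← Finset.sum_sub_distrib, add_div, add_comm (K / _)]
  refine (norm_add_le _ _).trans (add_le_add ?_ ?_)
  · exact hK' N hN _ (by
      intro m hm
      simp only [Finset.mem_sdiff, Finset.mem_Ico] at hm
      change m + (N : ℤ) < 0 ∨ (N : ℤ) ≤ m
      omega)
  · simp only [← mul_sub]
    exact hK N hN _ (by
      intro m hm
      simp only [Finset.mem_Ico] at hm
      change 0 ≤ m + (N : ℤ)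
      omega)

end Product

/-! ### Partial fractions by Laurent expansion -/

/-- The Laurent series `c + X`. -/
def linSeries (c : ℂ) : LaurentSeries ℂ := HahnSeries.C c + HahnSeries.single 1 1

/-- The coefficients of `(1 + X) ^ (-p)`. -/
def negBinom : ℕ → ℕ → ℚ
  | 0, e => if e = 0 then 1 else 0
  | p + 1, e => ∑ a ∈ Finset.HasAntidiagonal.antidiagonal e, negBinom p a.1 * (-1) ^ a.2

lemma negBinom_zero_right (p : ℕ) : negBinom p 0 = 1 := by
  induction p with
  | zero => simp [negBinom]
  | succ p ih => simp [negBinom, ih]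

/-- The power series expansion of `(l + X) ^ (-p)`; it vanishes for `l = 0` and `1 ≤ p`. -/
def powSeries (p : ℕ) (l : ℂ) : PowerSeries ℂ :=
  PowerSeries.mk fun e => (negBinom p e : ℂ) / l ^ (p + e)

lemma coeff_powSeries (p e : ℕ) (l : ℂ) :
    PowerSeries.coeff e (powSeries p l) = (negBinom p e : ℂ) / l ^ (p + e) :=
  PowerSeries.coeff_mk _ _

lemma powSeries_zero_right {p : ℕ} (hp : 1 ≤ p) : powSeries p 0 = 0 := by
  ext e
  rw [coeff_powSeries, zero_pow (by omega), div_zero, map_zero]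

lemma linSeries_eq_coe (c : ℂ) :
    linSeries c = HahnSeries.ofPowerSeries ℤ ℂ (PowerSeries.C c + PowerSeries.X) := by
  rw [map_add, HahnSeries.ofPowerSeries_C, HahnSeries.ofPowerSeries_X, linSeries]

lemma linSeries_ne_zero (c : ℂ) : linSeries c ≠ 0 := by
  rw [linSeries_eq_coe]
  intro h
  have := (map_eq_zero_iff _ HahnSeries.ofPowerSeries_injective).mp h
  have h1 := congrArg (PowerSeries.coeff 1) this
  simp at h1

lemma inv_linSeries {l : ℂ} (hl : l ≠ 0) : (linSeries l)⁻¹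
    = HahnSeries.ofPowerSeries ℤ ℂ (PowerSeries.mk fun e => (-1) ^ e / l ^ (e + 1)) := by
  refine inv_eq_of_mul_eq_one_right ?_
  rw [linSeries_eq_coe, ← map_mul, ← map_one (HahnSeries.ofPowerSeries ℤ ℂ)]
  congr 1
  ext e
  rw [add_mul, map_add, PowerSeries.coeff_C_mul, PowerSeries.coeff_mk]
  rcases e with _ | e
  · rw [PowerSeries.coeff_zero_X_mul]
    simp [hl]
  · rw [PowerSeries.coeff_succ_X_mul, PowerSeries.coeff_mk, PowerSeries.coeff_one,
      if_neg e.succ_ne_zero]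
    field_simp
    ring

lemma inv_linSeries_pow {l : ℂ} (hl : l ≠ 0) (p : ℕ) :
    (linSeries l)⁻¹ ^ p = HahnSeries.ofPowerSeries ℤ ℂ (powSeries p l) := by
  induction p with
  | zero =>
    rw [pow_zero, ← map_one (HahnSeries.ofPowerSeries ℤ ℂ)]
    congr 1
    ext e
    rw [coeff_powSeries, PowerSeries.coeff_one, negBinom]
    by_cases he : e = 0 <;> simp [he]
  | succ p ih =>
    rw [pow_succ, ih, inv_linSeries hl, ← map_mul]
    congr 1
    ext e
    rw [PowerSeries.coeff_mul, coeff_powSeries, negBinom]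
    push_cast
    rw [Finset.sum_div]
    refine Finset.sum_congr rfl fun a ha => ?_
    rw [coeff_powSeries, PowerSeries.coeff_mk, div_mul_div_comm, ← pow_add,
      ← Finset.HasAntidiagonal.mem_antidiagonal.mp ha]
    congr 2
    ring

lemma inv_linSeries_zero_pow (p : ℕ) :
    (linSeries 0)⁻¹ ^ p = HahnSeries.single (-(p : ℤ)) (1 : ℂ) := by
  rw [linSeries, map_zero, zero_add, HahnSeries.inv_single, HahnSeries.single_pow]
  simp

lemma inv_linSeries_pow_eq_add {p : ℕ} (hp : 1 ≤ p) (l : ℂ) : (linSeries l)⁻¹ ^ p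
    = (if l = 0 then HahnSeries.single (-(p : ℤ)) (1 : ℂ) else 0)
      + HahnSeries.ofPowerSeries ℤ ℂ (powSeries p l) := by
  split_ifs with h
  · rw [h, inv_linSeries_zero_pow, powSeries_zero_right hp, map_zero, add_zero]
  · rw [inv_linSeries_pow h, zero_add]

lemma coeff_ofPowerSeries_neg (f : PowerSeries ℂ) {i : ℕ} (hi : 1 ≤ i) :
    (HahnSeries.ofPowerSeries ℤ ℂ f).coeff (-(i : ℤ)) = 0 := by
  rw [PowerSeries.coeff_coe, if_pos (by omega)]

/-- The Laurent expansions of `s ↦ 1 / (s - a)` at all points. -/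
def pole (a : ℂ) : ℂ → LaurentSeries ℂ := fun b => (linSeries (b - a))⁻¹

lemma pole_mul_pole {a b : ℂ} (h : a ≠ b) :
    pole a * pole b = (a - b)⁻¹ • (pole a - pole b) := by
  funext c
  have h1 := linSeries_ne_zero (c - a)
  have h2 := linSeries_ne_zero (c - b)
  have h3 : linSeries (c - b) - linSeries (c - a) = HahnSeries.C (a - b) := by
    rw [linSeries, linSeries, add_sub_add_right_eq_sub, ← map_sub]
    congr 1
    ring
  have h4 : HahnSeries.C (a - b)⁻¹ * HahnSeries.C (a - b) = (1 : LaurentSeries ℂ) := by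
    rw [← map_mul, inv_mul_cancel₀ (sub_ne_zero.mpr h), map_one]
  simp only [Pi.mul_apply, Pi.smul_apply, Pi.sub_apply, pole]
  rw [← HahnSeries.C_mul_eq_smul, inv_sub_inv h1 h2, h3, mul_div_assoc', h4, one_div, mul_inv]

lemma smul_mul_expansions (c : ℂ) (f g : ℂ → LaurentSeries ℂ) : c • f * g = c • (f * g) := by
  funext b
  simp only [Pi.mul_apply, Pi.smul_apply, ← HahnSeries.C_mul_eq_smul, mul_assoc]

/-- Families of expansions of rational functions that vanish at infinity, have all poles in `T`
and order at most `n`. -/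
def poleSpan (T : Finset ℂ) (n : ℕ) : Submodule ℂ (ℂ → LaurentSeries ℂ) :=
  Submodule.span ℂ {g | ∃ a ∈ T, ∃ k, 1 ≤ k ∧ k ≤ n ∧ g = pole a ^ k}

lemma poleSpan_mono (T : Finset ℂ) {m n : ℕ} (h : m ≤ n) : poleSpan T m ≤ poleSpan T n :=
  Submodule.span_mono fun _ ⟨a, ha, k, h1, hk, e⟩ => ⟨a, ha, k, h1, hk.trans h, e⟩

lemma pole_pow_mem {T : Finset ℂ} {a : ℂ} (ha : a ∈ T) {k : ℕ} (hk : 1 ≤ k) :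
    pole a ^ k ∈ poleSpan T k :=
  Submodule.subset_span ⟨a, ha, k, hk, le_rfl, rfl⟩

/-- For distinct poles, each use of `pole_mul_pole` lowers the total exponent by one, whence the
induction on `k + l`. -/
lemma pole_pow_mul_pole_pow_mem {T : Finset ℂ} {a b : ℂ} (ha : a ∈ T) (hb : b ∈ T) (s : ℕ) :
    ∀ k l : ℕ, k + l = s → 1 ≤ s → pole a ^ k * pole b ^ l ∈ poleSpan T s := by
  by_cases hab : a = b
  · rintro k l rfl hs
    rw [hab, ← pow_add]
    exact pole_pow_mem hb hs
  induction s with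
  | zero => intro _ _ _ h; omega
  | succ s ih =>
    intro k l hkl _
    rcases k with _ | k
    · rw [pow_zero, one_mul, show l = s + 1 by omega]
      exact pole_pow_mem hb (by omega)
    rcases l with _ | l
    · rw [pow_zero, mul_one, show k = s by omega]
      exact pole_pow_mem ha (by omega)
    have e : pole a ^ (k + 1) * pole b ^ (l + 1) = (a - b)⁻¹ •
        (pole a ^ (k + 1) * pole b ^ l - pole a ^ k * pole b ^ (l + 1)) := by
      have : pole a ^ (k + 1) * pole b ^ (l + 1)
          = (pole a * pole b) * (pole a ^ k * pole b ^ l) := by ring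
      rw [this, pole_mul_pole hab, smul_mul_expansions]
      congr 1
      ring
    rw [e]
    refine (poleSpan T (s + 1)).smul_mem _ (poleSpan_mono T s.le_succ ?_)
    exact (poleSpan T s).sub_mem (ih _ _ (by omega) (by omega)) (ih _ _ (by omega) (by omega))

lemma mul_mem_poleSpan {T : Finset ℂ} {m n : ℕ} {f g : ℂ → LaurentSeries ℂ}
    (hf : f ∈ poleSpan T m) (hg : g ∈ poleSpan T n) : f * g ∈ poleSpan T (m + n) := by
  rw [poleSpan] at hf hg
  induction hf using Submodule.span_induction with
  | mem f h =>
    obtain ⟨a, ha, k, h1, hk, rfl⟩ := h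
    induction hg using Submodule.span_induction with
    | mem g h =>
      obtain ⟨b, hb, l, h2, hl, rfl⟩ := h
      exact poleSpan_mono T (by omega) (pole_pow_mul_pole_pow_mem ha hb (k + l) k l rfl (by omega))
    | zero => rw [mul_zero]; exact Submodule.zero_mem _
    | add f g _ _ hf hg => rw [mul_add]; exact Submodule.add_mem _ hf hg
    | smul c g _ hg =>
      rw [mul_comm, smul_mul_expansions, mul_comm]; exact Submodule.smul_mem _ _ hg
  | zero => rw [zero_mul]; exact Submodule.zero_mem _
  | add f g _ _ hf hg => rw [add_mul]; exact Submodule.add_mem _ hf hg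
  | smul c g _ hg => rw [smul_mul_expansions]; exact Submodule.smul_mem _ _ hg

/-- The constant coefficient at `m` of a rational function vanishing at infinity is the sum of
the values at `m` of its polar parts at the points different from `m`. -/
lemma coeff_zero_of_mem_poleSpan {T : Finset ℂ} {D : ℕ} {g : ℂ → LaurentSeries ℂ}
    (hg : g ∈ poleSpan T D) (m : ℂ) :
    (g m).coeff 0 = ∑ b ∈ T, ∑ i ∈ Finset.Icc 1 D, (g b).coeff (-(i : ℤ)) / (m - b) ^ i := by
  rw [poleSpan] at hg
  induction hg using Submodule.span_induction with
  | mem g h =>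
    obtain ⟨a, ha, k, h1, hk, rfl⟩ := h
    have hb : ∀ b ∈ T, b ≠ a →
        ∑ i ∈ Finset.Icc 1 D, ((pole a ^ k) b).coeff (-(i : ℤ)) / (m - b) ^ i = 0 := by
      intro b _ hba
      refine Finset.sum_eq_zero fun i hi => ?_
      rw [Pi.pow_apply, pole, inv_linSeries_pow (sub_ne_zero.mpr hba),
        coeff_ofPowerSeries_neg _ (Finset.mem_Icc.mp hi).1, zero_div]
    rw [Finset.sum_eq_single_of_mem a ha hb,
      Finset.sum_eq_single_of_mem k (Finset.mem_Icc.mpr ⟨h1, hk⟩)]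
    · simp only [Pi.pow_apply, pole, sub_self]
      rw [inv_linSeries_zero_pow, HahnSeries.coeff_single_same, inv_linSeries_pow_eq_add h1,
        HahnSeries.coeff_add, PowerSeries.coeff_coe, if_neg (lt_irrefl (0 : ℤ)), Int.natAbs_zero,
        coeff_powSeries, negBinom_zero_right]
      -- If `m` is the pole itself, the constant coefficient of `X^(-k)` is `0`, in agreement with
      -- the default value of `1 / 0^k`.
      split_ifs with h
      · rw [HahnSeries.coeff_single_of_ne (by omega)]
        simp
      · simp
    · intro i _ hik
      simp only [Pi.pow_apply, pole, sub_self]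
      rw [inv_linSeries_zero_pow, HahnSeries.coeff_single_of_ne (by omega), zero_div]
  | zero => simp
  | add f g _ _ hf hg =>
    simp only [Pi.add_apply, HahnSeries.coeff_add, hf, hg, add_div, Finset.sum_add_distrib]
  | smul c g _ hg =>
    simp only [Pi.smul_apply, HahnSeries.coeff_smul, hg, Finset.mul_sum, smul_eq_mul,
      mul_div_assoc]

/-! ### The truncated kernel -/

/-- The expansions of `∑_{k=1}^N x ^ k / (s + k) ^ p`. -/
def truncPolylog (N p : ℕ) (x : ℂ) : ℂ → LaurentSeries ℂ :=
  ∑ k ∈ Finset.range N, x ^ (k + 1) • pole (-((k : ℂ) + 1)) ^ p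

/-- The regular part of `x ^ m • truncPolylog N p x` at the integer `m`. -/
def regPart (N p : ℕ) (x : ℂ) (m : ℤ) : PowerSeries ℂ :=
  PowerSeries.mk fun e => (negBinom p e : ℂ) * (biZeta (p + e) x (m + N) - biZeta (p + e) x m)

lemma coeff_regPart (N p : ℕ) (x : ℂ) (m : ℤ) (e : ℕ) : PowerSeries.coeff e (regPart N p x m)
    = (negBinom p e : ℂ) * (biZeta (p + e) x (m + N) - biZeta (p + e) x m) :=
  PowerSeries.coeff_mk _ _

/-- About `s = m` only the summand with its pole at `m` is singular, and the factor `x^m` normalises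
its coefficient to `x^0 = 1`. In degree `e` the regular parts have exponent `p + e` and add up to a
`biZeta` difference by `sum_range_zpow_div`. -/
lemma truncPolylog_intCast {N p : ℕ} (hp : 1 ≤ p) {x : ℂ} (hx : x ≠ 0) (m : ℤ) :
    x ^ m • truncPolylog N p x m
      = (if -(N : ℤ) ≤ m ∧ m < 0 then HahnSeries.single (-(p : ℤ)) (1 : ℂ) else 0)
        + HahnSeries.ofPowerSeries ℤ ℂ (regPart N p x m) := by
  have hterm : ∀ k : ℕ, x ^ m • (x ^ (k + 1) • (pole (-((k : ℂ) + 1)) (m : ℂ)) ^ p)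
      = (if m + k + 1 = 0 then HahnSeries.single (-(p : ℤ)) (1 : ℂ) else 0)
        + HahnSeries.ofPowerSeries ℤ ℂ
          (x ^ (m + k + 1) • powSeries p ((m + k + 1 : ℤ) : ℂ)) := by
    intro k
    have e : (m : ℂ) - -((k : ℂ) + 1) = ((m + k + 1 : ℤ) : ℂ) := by push_cast; ring
    have e2 : x ^ m * x ^ (k + 1) = x ^ (m + k + 1) := by
      rw [← zpow_natCast, ← zpow_add₀ hx]; push_cast; rw [add_assoc]
    rw [pole, e, smul_smul, e2, inv_linSeries_pow_eq_add hp, smul_add]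
    congr 1
    · simp only [Int.cast_eq_zero]
      split_ifs with h
      · rw [h, zpow_zero, one_smul]
      · rw [smul_zero]
    · rw [← HahnSeries.C_mul_eq_smul, ← HahnSeries.ofPowerSeries_C, ← map_mul,
        PowerSeries.smul_eq_C_mul]
  have hreg : ∑ k ∈ Finset.range N, x ^ (m + k + 1) • powSeries p ((m + k + 1 : ℤ) : ℂ)
      = regPart N p x m := by
    ext e
    rw [coeff_regPart, ← sum_range_zpow_div (by omega), map_sum, Finset.mul_sum]
    refine Finset.sum_congr rfl fun k _ => ?_
    rw [map_smul, coeff_powSeries, smul_eq_mul]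
    ring
  have e : truncPolylog N p x (m : ℂ)
      = ∑ k ∈ Finset.range N, x ^ (k + 1) • (pole (-((k : ℂ) + 1)) (m : ℂ)) ^ p := by
    simp [truncPolylog, Finset.sum_apply]
  rw [e, Finset.smul_sum, Finset.sum_congr rfl fun k _ => hterm k, Finset.sum_add_distrib,
    ← map_sum, hreg]
  congr 1
  split_ifs with h
  · obtain ⟨n, rfl⟩ := Int.eq_negSucc_of_lt_zero h.2
    rw [Finset.sum_eq_single_of_mem n (Finset.mem_range.mpr (by omega)), if_pos (by omega)]
    intro k _ hk
    rw [if_neg (by omega)]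
  · refine Finset.sum_eq_zero fun k hk => if_neg ?_
    have := Finset.mem_range.mp hk
    omega

/-- The expansion of `∑_{k=1}^N x ^ k / (s + k) ^ p` at `s = -1/2`. -/
def halfPart (N p : ℕ) (x : ℂ) : PowerSeries ℂ :=
  PowerSeries.mk fun e => (negBinom p e : ℂ) *
    (x * ∑ k ∈ Finset.range N, x ^ k / ((k : ℂ) + 1 / 2) ^ (p + e))

lemma natCast_add_half_ne_zero (k : ℕ) : (k : ℂ) + 1 / 2 ≠ 0 := by
  simpa using intCast_add_half_ne_zero k

lemma truncPolylog_neg_half (N p : ℕ) (x : ℂ) :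
    truncPolylog N p x (-(1 / 2)) = HahnSeries.ofPowerSeries ℤ ℂ (halfPart N p x) := by
  have e : truncPolylog N p x (-(1 / 2))
      = ∑ k ∈ Finset.range N, x ^ (k + 1) • (pole (-((k : ℂ) + 1)) (-(1 / 2))) ^ p := by
    simp [truncPolylog, Finset.sum_apply]
  have h : halfPart N p x
      = ∑ k ∈ Finset.range N, x ^ (k + 1) • powSeries p ((k : ℂ) + 1 / 2) := by
    ext e
    rw [halfPart, PowerSeries.coeff_mk, map_sum, Finset.mul_sum, Finset.mul_sum]
    refine Finset.sum_congr rfl fun k _ => ?_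
    rw [map_smul, coeff_powSeries, smul_eq_mul]
    ring
  rw [e, h, map_sum]
  refine Finset.sum_congr rfl fun k _ => ?_
  rw [pole, show -(1 / 2) - -((k : ℂ) + 1) = (k : ℂ) + 1 / 2 by ring,
    inv_linSeries_pow (natCast_add_half_ne_zero k), ← HahnSeries.C_mul_eq_smul,
    ← HahnSeries.ofPowerSeries_C, ← map_mul, PowerSeries.smul_eq_C_mul]

section Kernel

variable {ι : Type*} [Fintype ι]

/-- The expansions of `(s + 1/2) ^ (-q) * ∏_j ∑_{k=1}^N x_j ^ k / (s + k) ^ (p_j)`. -/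
def truncKernel (N : ℕ) (p : ι → ℕ) (q : ℕ) (xs : ι → ℂ) : ℂ → LaurentSeries ℂ :=
  pole (-(1 / 2)) ^ q * ∏ j, truncPolylog N (p j) (xs j)

lemma truncPolylog_mem_poleSpan {T : Finset ℂ} {N : ℕ}
    (hT : ∀ k < N, -((k : ℂ) + 1) ∈ T) {p : ℕ} (hp : 1 ≤ p) (x : ℂ) :
    truncPolylog N p x ∈ poleSpan T p :=
  Submodule.sum_mem _ fun k hk => Submodule.smul_mem _ _ <|
    pole_pow_mem (hT k (Finset.mem_range.mp hk)) hp

lemma truncKernel_mem_poleSpan {T : Finset ℂ} {N : ℕ} (hT : ∀ k < N, -((k : ℂ) + 1) ∈ T)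
    (hT' : -(1 / 2) ∈ T) {p : ι → ℕ} (hp : ∀ j, 1 ≤ p j) {q : ℕ} (hq : 1 ≤ q) (xs : ι → ℂ) :
    truncKernel N p q xs ∈ poleSpan T (q + ∑ j, p j) := by
  classical
  have key : ∀ s : Finset ι, pole (-(1 / 2)) ^ q * ∏ j ∈ s, truncPolylog N (p j) (xs j)
      ∈ poleSpan T (q + ∑ j ∈ s, p j) := by
    intro s
    induction s using Finset.induction_on with
    | empty => simpa using pole_pow_mem hT' hq
    | insert a s ha ih =>
      rw [Finset.prod_insert ha, Finset.sum_insert ha, mul_left_comm, add_left_comm]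
      exact mul_mem_poleSpan (truncPolylog_mem_poleSpan hT (hp a) _) ih
  exact key Finset.univ

/-- The partial fraction decomposition of the truncated kernel at integers. -/
lemma coeff_zero_truncKernel {p : ι → ℕ} (hp : ∀ j, 1 ≤ p j) {q : ℕ} (hq : 1 ≤ q) (xs : ι → ℂ)
    (N : ℕ) (m : ℤ) :
    (truncKernel N p q xs m).coeff 0
      = ∑ i ∈ Finset.Icc 1 (q + ∑ j, p j),
          (truncKernel N p q xs (-(1 / 2))).coeff (-(i : ℤ)) / ((m : ℂ) + 1 / 2) ^ i
        + ∑ n ∈ Finset.range N, ∑ i ∈ Finset.Icc 1 (q + ∑ j, p j),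
          (truncKernel N p q xs (Int.negSucc n : ℤ)).coeff (-(i : ℤ))
            / ((m : ℂ) - (Int.negSucc n : ℤ)) ^ i := by
  classical
  have hinj : Function.Injective fun n : ℕ => ((Int.negSucc n : ℤ) : ℂ) := fun a b h => by
    have := Int.cast_injective h
    omega
  have hcast : ∀ k : ℕ, ((Int.negSucc k : ℤ) : ℂ) = -((k : ℂ) + 1) := fun k => by
    rw [Int.cast_negSucc]; push_cast; rfl
  set T₀ : Finset ℂ := (Finset.range N).map ⟨fun n : ℕ => ((Int.negSucc n : ℤ) : ℂ), hinj⟩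
  have hnot : -(1 / 2 : ℂ) ∉ T₀ := by
    intro h
    obtain ⟨n, -, hn⟩ := Finset.mem_map.mp h
    refine intCast_add_half_ne_zero (Int.negSucc n) ?_
    have : ((Int.negSucc n : ℤ) : ℂ) = -(1 / 2) := hn
    rw [this]
    norm_num
  have := coeff_zero_of_mem_poleSpan (T := insert (-(1 / 2 : ℂ)) T₀)
    (truncKernel_mem_poleSpan (N := N) (fun k hk => Finset.mem_insert_of_mem
      (Finset.mem_map.mpr ⟨k, Finset.mem_range.mpr hk, hcast k⟩))
      (Finset.mem_insert_self _ _) hp hq xs) m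
  rw [Finset.sum_insert hnot, Finset.sum_map, sub_neg_eq_add] at this
  exact this

lemma coeff_truncKernel_neg_half {p : ι → ℕ} {q : ℕ} (xs : ι → ℂ) (N : ℕ) (i : ℕ) :
    (truncKernel N p q xs (-(1 / 2))).coeff (-(i : ℤ))
      = if i ≤ q then PowerSeries.coeff (q - i) (∏ j, halfPart N (p j) (xs j)) else 0 := by
  have e : truncKernel N p q xs (-(1 / 2)) = HahnSeries.single (-(q : ℤ)) (1 : ℂ)
      * HahnSeries.ofPowerSeries ℤ ℂ (∏ j, halfPart N (p j) (xs j)) := by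
    rw [truncKernel, Pi.mul_apply, Pi.pow_apply, Finset.prod_apply, pole, sub_self,
      inv_linSeries_zero_pow, map_prod]
    simp only [truncPolylog_neg_half]
  rw [e, HahnSeries.coeff_single_mul, one_mul, PowerSeries.coeff_coe]
  split_ifs with h1 h2 h2
  · omega
  · rfl
  · rw [show (-(i : ℤ) - -(q : ℤ)).natAbs = q - i by omega]
  · omega

/-- The coefficients of the products of regular parts over a set of indices. -/
def lowCoeff (N : ℕ) (p : ι → ℕ) (q : ℕ) (xs : ι → ℂ) (J : Finset ι) (e : ℕ) (m : ℤ) : ℂ :=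
  PowerSeries.coeff e (powSeries q ((m : ℂ) + 1 / 2) * ∏ j ∈ J, regPart N (p j) (xs j) m)

lemma zpow_smul_truncKernel {p : ι → ℕ} (hp : ∀ j, 1 ≤ p j) {q : ℕ} {xs : ι → ℂ} {x : ℂ}
    (hxs : ∀ j, xs j ≠ 0) (N : ℕ) (m : ℤ) :
    (x * ∏ j, xs j) ^ m • truncKernel N p q xs m
      = x ^ m • (HahnSeries.ofPowerSeries ℤ ℂ (powSeries q ((m : ℂ) + 1 / 2))
        * ∏ j, (HahnSeries.ofPowerSeries ℤ ℂ (regPart N (p j) (xs j) m) +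
          (if -(N : ℤ) ≤ m ∧ m < 0 then HahnSeries.single (-(p j : ℤ)) (1 : ℂ) else 0))) := by
  have h : ∀ j, HahnSeries.ofPowerSeries ℤ ℂ (regPart N (p j) (xs j) m) +
      (if -(N : ℤ) ≤ m ∧ m < 0 then HahnSeries.single (-(p j : ℤ)) (1 : ℂ) else 0)
      = xs j ^ m • truncPolylog N (p j) (xs j) m := fun j => by
    rw [truncPolylog_intCast (hp j) (hxs j), add_comm]
  simp only [h]
  rw [truncKernel, Pi.mul_apply, Pi.pow_apply, Finset.prod_apply, pole, sub_neg_eq_add,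
    inv_linSeries_pow (intCast_add_half_ne_zero m), mul_zpow, ← smul_smul, ← Finset.prod_zpow]
  congr 1
  simp only [← HahnSeries.C_mul_eq_smul]
  rw [Finset.prod_mul_distrib, map_prod]
  ring

/-- The product is expanded over the set `J` of indices contributing their regular part; the
complement contributes the pure power `X^(-∑ p_j)`. For `i ≥ 1` the set `J = univ` has polar order
`0` and drops out, so only products of fewer factors remain. -/
lemma coeff_zpow_smul_truncKernel_of_neg [DecidableEq ι] {p : ι → ℕ} (hp : ∀ j, 1 ≤ p j) {q : ℕ}
    {xs : ι → ℂ} {x : ℂ} (hxs : ∀ j, xs j ≠ 0) (N : ℕ) {m : ℤ} (hm : -(N : ℤ) ≤ m ∧ m < 0)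
    (i : ℕ) :
    (x * ∏ j, xs j) ^ m * (truncKernel N p q xs m).coeff (-(i : ℤ))
      = x ^ m * ∑ J : Finset ι, if i ≤ ∑ j ∈ Finset.univ \ J, p j then
          lowCoeff N p q xs J (∑ j ∈ Finset.univ \ J, p j - i) m else 0 := by
  rw [← smul_eq_mul, ← HahnSeries.coeff_smul, zpow_smul_truncKernel hp hxs, HahnSeries.coeff_smul,
    smul_eq_mul]
  congr 1
  simp only [if_pos hm]
  rw [Finset.prod_add, Finset.mul_sum, HahnSeries.coeff_sum, Finset.powerset_univ]
  refine Finset.sum_congr rfl fun J _ => ?_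
  have hs : ∏ j ∈ Finset.univ \ J, HahnSeries.single (-(p j : ℤ)) (1 : ℂ)
      = HahnSeries.single (-((∑ j ∈ Finset.univ \ J, p j : ℕ) : ℤ)) 1 := by
    induction Finset.univ \ J using Finset.induction_on with
    | empty => simp
    | insert a s ha ih =>
      rw [Finset.prod_insert ha, ih, Finset.sum_insert ha, HahnSeries.single_mul_single, mul_one]
      congr 1
      push_cast
      ring_nf
  rw [hs, ← map_prod, ← mul_assoc, ← map_mul, mul_comm, HahnSeries.coeff_single_mul, one_mul,
    PowerSeries.coeff_coe, lowCoeff]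
  split_ifs with h1 h2 h2
  · omega
  · rfl
  · rw [show (-(i : ℤ) - -((∑ j ∈ Finset.univ \ J, p j : ℕ) : ℤ)).natAbs
      = ∑ j ∈ Finset.univ \ J, p j - i by omega]
  · omega

end Kernel

lemma lowCoeff_zero {ι : Type*} (p : ι → ℕ) (q : ℕ) (xs : ι → ℂ) (J : Finset ι) (N : ℕ) (m : ℤ) :
    lowCoeff N p q xs J 0 m = 1 / ((m : ℂ) + 1 / 2) ^ q
      * ∏ j ∈ J, (biZeta (p j) (xs j) (m + N) - biZeta (p j) (xs j) m) := by
  have hc : ∀ j, PowerSeries.constantCoeff (regPart N (p j) (xs j) m)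
      = biZeta (p j) (xs j) (m + N) - biZeta (p j) (xs j) m := fun j => by
    rw [← PowerSeries.coeff_zero_eq_constantCoeff_apply, coeff_regPart, negBinom_zero_right]
    simp
  rw [lowCoeff, PowerSeries.coeff_zero_eq_constantCoeff_apply, map_mul, map_prod]
  simp only [hc]
  rw [← PowerSeries.coeff_zero_eq_constantCoeff_apply, coeff_powSeries, negBinom_zero_right]
  simp

/-! ### The module of lower combinations -/

lemma isOfFinOrder_inv {y : ℂ} (hy : IsOfFinOrder y) : IsOfFinOrder y⁻¹ := by
  obtain ⟨n, hn, h⟩ := isOfFinOrder_iff_pow_eq_one.mp hy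
  exact isOfFinOrder_iff_pow_eq_one.mpr ⟨n, hn, by rw [inv_pow, h, inv_one]⟩

section Module

variable {r : ℕ} {xs : Fin r → ℂ} {x : ℂ}

lemma mul_mem_rootMonomials (hx : x ≠ 0) (hxs : ∀ j, xs j ≠ 0) {u v : ℂ}
    (hu : u ∈ rootMonomials xs x) (hv : v ∈ rootMonomials xs x) :
    u * v ∈ rootMonomials xs x := by
  obtain ⟨a, b, rfl⟩ := hu
  obtain ⟨c, d, rfl⟩ := hv
  refine ⟨a + c, fun j => b j + d j, ?_⟩
  simp only [zpow_add₀ hx, fun j => zpow_add₀ (hxs j), Finset.prod_mul_distrib]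
  ring

lemma monomial_mul_mem (hx : x ≠ 0) (hxs : ∀ j, xs j ≠ 0) {u a : ℂ}
    (hu : u ∈ rootMonomials xs x) (ha : a ∈ lowerCombinations xs x) :
    u * a ∈ lowerCombinations xs x := by
  rw [lowerCombinations] at ha ⊢
  induction ha using Submodule.span_induction with
  | mem a h =>
    obtain ⟨v, hv, P, hP, rfl⟩ := h
    exact Submodule.subset_span
      ⟨u * v, mul_mem_rootMonomials hx hxs hu hv, P, hP, (mul_assoc _ _ _).symm⟩
  | zero => rw [mul_zero]; exact Submodule.zero_mem _
  | add a b _ _ ha hb => rw [mul_add]; exact Submodule.add_mem _ ha hb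
  | smul c a _ ha => rw [mul_smul_comm]; exact Submodule.smul_mem _ _ ha

lemma mul_mem_lowerCombinations (hx : x ≠ 0) (hxs : ∀ j, xs j ≠ 0) {a b : ℂ}
    (ha : a ∈ lowerCombinations xs x) (hb : b ∈ lowerCombinations xs x) :
    a * b ∈ lowerCombinations xs x := by
  have h := Submodule.mul_mem_mul ha hb
  rw [lowerCombinations, Submodule.span_mul_span] at h
  refine (Submodule.span_mono ?_) h
  rintro _ ⟨_, ⟨u, hu, P, hP, rfl⟩, _, ⟨v, hv, Q, hQ, rfl⟩, rfl⟩
  exact ⟨u * v, mul_mem_rootMonomials hx hxs hu hv, P * Q, mul_mem hP hQ,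
    mul_mul_mul_comm _ _ _ _⟩

lemma ratCast_mul_mem_lowerCombinations (c : ℚ) {a : ℂ} (ha : a ∈ lowerCombinations xs x) :
    (c : ℂ) * a ∈ lowerCombinations xs x := by
  rw [← Rat.smul_def]
  exact Submodule.smul_mem _ _ ha

lemma zpow_mem_rootMonomials (a : ℤ) : x ^ a ∈ rootMonomials xs x := ⟨a, 0, by simp⟩

lemma zpow_mul_prod_mem_rootMonomials (a : ℤ) :
    (x * ∏ j, xs j) ^ a ∈ rootMonomials xs x :=
  ⟨a, fun _ => a, by rw [mul_zpow, Finset.prod_zpow]⟩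

lemma lowerSums_subset {v : ℂ} (hv : v ∈ lowerSums r) : v ∈ lowerCombinations xs x :=
  Submodule.subset_span ⟨1, ⟨0, 0, by simp⟩, v, Subsemigroup.subset_closure hv, (one_mul v).symm⟩

lemma polylog_mem (hr : 1 ≤ r) {p : ℕ} {y : ℂ} (hp : 1 ≤ p) (hy : IsOfFinOrder y)
    (h : (p, y) ≠ (1, 1)) : polylog p y ∈ lowerCombinations xs x :=
  lowerSums_subset ⟨0, Fin.elim0, p, Fin.elim0, y, hr,
    ⟨fun j => j.elim0, hp, fun j => j.elim0, hy, h⟩, Or.inl rfl⟩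

variable (xs x) in
/-- The sequence converges to a lower combination. -/
def LimMem (f : ℕ → ℂ) : Prop := ∃ v ∈ lowerCombinations xs x, Tendsto f atTop (𝓝 v)

namespace LimMem

variable {f g : ℕ → ℂ}

lemma congr (h : LimMem xs x f) (e : ∀ n, f n = g n) : LimMem xs x g := by
  rwa [← funext e]

lemma add (hf : LimMem xs x f) (hg : LimMem xs x g) : LimMem xs x fun n => f n + g n := by
  obtain ⟨a, ha, hf⟩ := hf
  obtain ⟨b, hb, hg⟩ := hg
  exact ⟨a + b, Submodule.add_mem _ ha hb, hf.add hg⟩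

lemma neg (hf : LimMem xs x f) : LimMem xs x fun n => -f n := by
  obtain ⟨a, ha, hf⟩ := hf
  exact ⟨-a, Submodule.neg_mem _ ha, hf.neg⟩

lemma sub (hf : LimMem xs x f) (hg : LimMem xs x g) : LimMem xs x fun n => f n - g n := by
  simpa only [sub_eq_add_neg] using hf.add hg.neg

lemma zero : LimMem xs x fun _ => 0 := ⟨0, Submodule.zero_mem _, tendsto_const_nhds⟩

lemma const {c : ℂ} (hc : c ∈ lowerCombinations xs x) : LimMem xs x fun _ => c :=
  ⟨c, hc, tendsto_const_nhds⟩

lemma add_tendsto_zero (hf : LimMem xs x f) (hg : Tendsto g atTop (𝓝 0)) :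
    LimMem xs x fun n => f n + g n := by
  obtain ⟨a, ha, hf⟩ := hf
  exact ⟨a, ha, by simpa using hf.add hg⟩

lemma sum {ι : Type*} (s : Finset ι) {f : ι → ℕ → ℂ} (h : ∀ i ∈ s, LimMem xs x (f i)) :
    LimMem xs x fun n => ∑ i ∈ s, f i n := by
  classical
  induction s using Finset.induction_on with
  | empty => simpa using zero
  | insert a s ha ih =>
    simp only [Finset.sum_insert ha]
    exact (h a (Finset.mem_insert_self _ _)).add (ih fun j hj => h j (Finset.mem_insert_of_mem hj))

lemma ratCast_mul (c : ℚ) (hf : LimMem xs x f) : LimMem xs x fun n => (c : ℂ) * f n := by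
  obtain ⟨a, ha, hf⟩ := hf
  exact ⟨_, ratCast_mul_mem_lowerCombinations c ha, hf.const_mul _⟩

lemma neg_one_pow_mul (k : ℕ) (hf : LimMem xs x f) : LimMem xs x fun n => (-1) ^ k * f n := by
  simpa using hf.ratCast_mul ((-1) ^ k)

lemma mul (hx : x ≠ 0) (hxs : ∀ j, xs j ≠ 0) (hf : LimMem xs x f) (hg : LimMem xs x g) :
    LimMem xs x fun n => f n * g n := by
  obtain ⟨a, ha, hf⟩ := hf
  obtain ⟨b, hb, hg⟩ := hg
  exact ⟨_, mul_mem_lowerCombinations hx hxs ha hb, hf.mul hg⟩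

lemma mul_prod (hx : x ≠ 0) (hxs : ∀ j, xs j ≠ 0) {ι : Type*} (s : Finset ι) {g : ι → ℕ → ℂ}
    (hf : LimMem xs x f) (hg : ∀ i ∈ s, LimMem xs x (g i)) :
    LimMem xs x fun n => f n * ∏ i ∈ s, g i n := by
  classical
  induction s using Finset.induction_on with
  | empty => simpa using hf
  | insert a s ha ih =>
    simp only [Finset.prod_insert ha, mul_left_comm (f _)]
    exact (hg a (Finset.mem_insert_self _ _)).mul hx hxs
      (ih fun j hj => hg j (Finset.mem_insert_of_mem hj))

lemma monomial_mul (hx : x ≠ 0) (hxs : ∀ j, xs j ≠ 0) {u : ℂ} (hu : u ∈ rootMonomials xs x)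
    (hf : LimMem xs x f) : LimMem xs x fun n => u * f n := by
  obtain ⟨a, ha, hf⟩ := hf
  exact ⟨_, monomial_mul_mem hx hxs hu ha, hf.const_mul _⟩

end LimMem

/-- Partial sums of an `R`-sum indexed by fewer than `r` of the indices. -/
lemma limMem_halfEuler (J : Finset (Fin r)) (hJ : J.card < r) {p : Fin r → ℕ} {q : ℕ}
    {ys : Fin r → ℂ} {y : ℂ} (hp : ∀ j, 1 ≤ p j) (hq : 1 ≤ q) (hys : ∀ j, IsOfFinOrder (ys j))
    (hy : IsOfFinOrder y) (hpy : ∀ j, (p j, ys j) ≠ (1, 1)) (h : (q, y) ≠ (1, 1)) :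
    LimMem xs x fun N => ∑ n ∈ Finset.range N,
      (∏ j ∈ J, zetaFin n (p j) (ys j)) / ((n : ℂ) + 1 / 2) ^ q * y ^ n := by
  obtain ⟨S, hS⟩ := halfEuler_converges J (fun j _ => hp j) hq
    (fun j _ => (hys j).norm_eq_one) hy.norm_eq_one (fun j _ => hpy j) h
  -- Sums of order `k` are indexed by `Fin k`, so the subset `J` is enumerated by `J.equivFin`.
  have e : partialR (fun i => p (J.equivFin.symm i)) q (fun i => ys (J.equivFin.symm i)) y
      = fun N => ∑ n ∈ Finset.range N,
        (∏ j ∈ J, zetaFin n (p j) (ys j)) / ((n : ℂ) + 1 / 2) ^ q * y ^ n := by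
    funext N
    refine Finset.sum_congr rfl fun n _ => ?_
    rw [Equiv.prod_comp J.equivFin.symm fun j : J => zetaFin n (p j) (ys j),
      Finset.prod_coe_sort J fun j => zetaFin n (p j) (ys j)]
  refine ⟨eulerR (fun i => p (J.equivFin.symm i)) q (fun i => ys (J.equivFin.symm i)) y,
    lowerSums_subset ⟨J.card, _, q, _, y, hJ, ⟨fun i => hp _, hq, fun i => hys _, hy, h⟩,
      Or.inr rfl⟩, ?_⟩
  rw [eulerR, e]
  exact tendsto_nhds_limUnder ⟨S, hS⟩

/-- Up to lower combinations, only the leading term of a product of affine functions of the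
finite polylogarithms contributes. -/
lemma limMem_affine_sub (hx : x ≠ 0) (hxs : ∀ j, xs j ≠ 0) (J : Finset (Fin r))
    {p : Fin r → ℕ} {q : ℕ} {ys : Fin r → ℂ} {y : ℂ} (hp : ∀ j, 1 ≤ p j) (hq : 1 ≤ q)
    (hys : ∀ j, IsOfFinOrder (ys j)) (hy : IsOfFinOrder y) (hpy : ∀ j, (p j, ys j) ≠ (1, 1))
    (h : (q, y) ≠ (1, 1)) {a : Fin r → ℂ} (ha : ∀ j, a j ∈ lowerCombinations xs x)
    (s : Fin r → ℚ) :
    LimMem xs x fun N => ∑ n ∈ Finset.range N,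
      (∏ j ∈ J, (s j * zetaFin n (p j) (ys j) + a j) - ∏ j ∈ J, s j * zetaFin n (p j) (ys j))
        / ((n : ℂ) + 1 / 2) ^ q * y ^ n := by
  -- Expanding the product, `t` is the set of indices contributing a `ζ_n`. Removing the leading
  -- term `t = J` leaves proper subsets, hence orders below `r`, with constants `a j` as cofactors.
  have main : LimMem xs x fun N => ∑ t ∈ J.powerset.erase J,
      ((∏ j ∈ t, s j : ℚ) : ℂ) * ((∑ n ∈ Finset.range N,
        (∏ j ∈ t, zetaFin n (p j) (ys j)) / ((n : ℂ) + 1 / 2) ^ q * y ^ n) * ∏ j ∈ J \ t, a j) := by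
    refine LimMem.sum _ fun t ht => LimMem.ratCast_mul _ (LimMem.mul_prod hx hxs _ ?_
      fun j _ => LimMem.const (ha j))
    rw [Finset.mem_erase, Finset.mem_powerset] at ht
    refine limMem_halfEuler t ?_ hp hq hys hy hpy h
    exact (Finset.card_lt_card (Finset.ssubset_iff_subset_ne.mpr ⟨ht.2, ht.1⟩)).trans_le
      ((Finset.card_le_univ J).trans (by simp))
  refine main.congr fun N => ?_
  have e : ∀ n, ∏ j ∈ J, (s j * zetaFin n (p j) (ys j) + a j)
      - ∏ j ∈ J, s j * zetaFin n (p j) (ys j)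
      = ∑ t ∈ J.powerset.erase J, ((∏ j ∈ t, s j : ℚ) : ℂ) *
          (∏ j ∈ t, zetaFin n (p j) (ys j)) * ∏ j ∈ J \ t, a j := by
    intro n
    rw [Finset.prod_add, ← Finset.add_sum_erase _ _ (Finset.mem_powerset_self J),
      Finset.sdiff_self, Finset.prod_empty, mul_one, add_sub_cancel_left]
    refine Finset.sum_congr rfl fun t _ => ?_
    rw [Finset.prod_mul_distrib]
    push_cast
    rfl
  simp only [e, Finset.sum_div, Finset.sum_mul, Finset.mul_sum]
  rw [Finset.sum_comm]
  refine Finset.sum_congr rfl fun n _ => Finset.sum_congr rfl fun t _ => ?_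
  ring

lemma limMem_affine (hx : x ≠ 0) (hxs : ∀ j, xs j ≠ 0) (J : Finset (Fin r)) (hJ : J.card < r)
    {p : Fin r → ℕ} {q : ℕ} {ys : Fin r → ℂ} {y : ℂ} (hp : ∀ j, 1 ≤ p j) (hq : 1 ≤ q)
    (hys : ∀ j, IsOfFinOrder (ys j)) (hy : IsOfFinOrder y) (hpy : ∀ j, (p j, ys j) ≠ (1, 1))
    (h : (q, y) ≠ (1, 1)) {a : Fin r → ℂ} (ha : ∀ j, a j ∈ lowerCombinations xs x)
    (s : Fin r → ℚ) :
    LimMem xs x fun N => ∑ n ∈ Finset.range N,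
      (∏ j ∈ J, (s j * zetaFin n (p j) (ys j) + a j)) / ((n : ℂ) + 1 / 2) ^ q * y ^ n := by
  have h1 := limMem_affine_sub hx hxs J hp hq hys hy hpy h ha s
  have h2 := (limMem_halfEuler (xs := xs) (x := x) J hJ hp hq hys hy hpy h).ratCast_mul
    (∏ j ∈ J, s j)
  refine (h1.add h2).congr fun N => ?_
  rw [Finset.mul_sum, ← Finset.sum_add_distrib]
  refine Finset.sum_congr rfl fun n _ => ?_
  rw [Finset.prod_mul_distrib]
  push_cast
  ring

/-- The weight of the index `-n - 1` in terms of the weight of `n`. -/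
lemma zpow_negSucc_div (y : ℂ) (q n : ℕ) :
    y ^ (Int.negSucc n) / (((Int.negSucc n : ℤ) : ℂ) + 1 / 2) ^ q
      = y⁻¹ * ((-1) ^ q * (y⁻¹ ^ n / ((n : ℂ) + 1 / 2) ^ q)) := by
  have e : ((Int.negSucc n : ℤ) : ℂ) + 1 / 2 = -((n : ℂ) + 1 / 2) := by
    rw [Int.cast_negSucc]; push_cast; ring
  have h2 : ((-1 : ℂ) ^ q)⁻¹ = (-1) ^ q := by rw [← inv_pow]; norm_num
  rw [e, neg_pow ((n : ℂ) + 1 / 2), zpow_negSucc, div_eq_mul_inv, mul_inv, h2, pow_succ, mul_inv]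
  ring

/-! ### Limits of sums over the negative integers -/

lemma limMem_negSucc_polylog (hr : 1 ≤ r) (J : Finset (Fin r)) (hJ : J.card < r) {p : Fin r → ℕ}
    {q : ℕ} (hp : ∀ j, 1 ≤ p j) (hq : 1 ≤ q) (hxs : ∀ j, IsOfFinOrder (xs j))
    (hx : IsOfFinOrder x) (hpx : ∀ j, (p j, xs j) ≠ (1, 1)) (hqx : (q, x) ≠ (1, 1)) :
    LimMem xs x fun N => ∑ n ∈ Finset.range N,
      x ^ (Int.negSucc n) / (((Int.negSucc n : ℤ) : ℂ) + 1 / 2) ^ q *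
        ∏ j ∈ J, (polylog (p j) (xs j) - biZeta (p j) (xs j) (Int.negSucc n)) := by
  have hx0 : x ≠ 0 := norm_ne_zero_iff.mp (by rw [hx.norm_eq_one]; exact one_ne_zero)
  have hxs0 : ∀ j, xs j ≠ 0 := fun j =>
    norm_ne_zero_iff.mp (by rw [(hxs j).norm_eq_one]; exact one_ne_zero)
  have h := limMem_affine hx0 hxs0 J hJ (ys := fun j => (xs j)⁻¹) (y := x⁻¹) hp hq
    (fun j => isOfFinOrder_inv (hxs j)) (isOfFinOrder_inv hx) (fun j => inv_ne_pair (hpx j)) (inv_ne_pair hqx)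
    (a := fun j => polylog (p j) (xs j)) (fun j => polylog_mem hr (hp j) (hxs j) (hpx j))
    -- At `-n - 1` each factor is affine in `ζ_n(p_j; x_j⁻¹)`, with this sign as slope and the
    -- polylogarithm as constant term.
    (fun j => -(-1) ^ (p j + 1))
  refine ((h.neg_one_pow_mul q).monomial_mul hx0 hxs0 (zpow_mem_rootMonomials (-1))).congr
    fun N => ?_
  rw [Finset.mul_sum, Finset.mul_sum]
  refine Finset.sum_congr rfl fun n _ => ?_
  rw [zpow_negSucc_div, zpow_neg_one]
  have : ∀ j, ((-(-1) ^ (p j + 1) : ℚ) : ℂ) * zetaFin n (p j) (xs j)⁻¹ + polylog (p j) (xs j)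
      = polylog (p j) (xs j) - biZeta (p j) (xs j) (Int.negSucc n) := fun j => by
    rw [biZeta_negSucc]; push_cast; ring
  simp only [this]
  ring

/-- The summand itself depends on `N`; by `truncation_error_neg` it may be replaced by its limiting
form without changing the limit of the sum. -/
lemma limMem_negSucc_diff (hr : 1 ≤ r) (J : Finset (Fin r)) (hJ : J.card < r) {p : Fin r → ℕ}
    {q : ℕ} (hp : ∀ j, 1 ≤ p j) (hq : 1 ≤ q) (hxs : ∀ j, IsOfFinOrder (xs j))
    (hx : IsOfFinOrder x) (hpx : ∀ j, (p j, xs j) ≠ (1, 1)) (hqx : (q, x) ≠ (1, 1)) :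
    LimMem xs x fun N => ∑ n ∈ Finset.range N,
      x ^ (Int.negSucc n) / (((Int.negSucc n : ℤ) : ℂ) + 1 / 2) ^ q *
        ∏ j ∈ J, (biZeta (p j) (xs j) (Int.negSucc n + N)
          - biZeta (p j) (xs j) (Int.negSucc n)) := by
  have h1 := limMem_negSucc_polylog hr J hJ hp hq hxs hx hpx hqx
  have h2 := truncation_error_neg J (fun j _ => hp j) hq (fun j _ => (hxs j).norm_eq_one)
    hx.norm_eq_one (fun j _ => hpx j)
  refine (h1.add_tendsto_zero h2).congr fun N => ?_
  rw [← Finset.sum_add_distrib]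
  exact Finset.sum_congr rfl fun n _ => by ring

lemma add_ne_pair {p : ℕ} {y : ℂ} (hp : 1 ≤ p) (h : (p, y) ≠ (1, 1)) (e : ℕ) :
    (p + e, y) ≠ (1, 1) := by
  intro he
  rw [Prod.mk.injEq] at he
  exact h (by rw [Prod.mk.injEq]; exact ⟨by omega, he.2⟩)

lemma lowCoeff_eq {ι : Type*} [DecidableEq ι] (N : ℕ) (p : ι → ℕ) (q : ℕ) (xs : ι → ℂ)
    (J : Finset ι) (e : ℕ) (m : ℤ) :
    lowCoeff N p q xs J e m = ∑ a ∈ Finset.HasAntidiagonal.antidiagonal e,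
      ∑ l ∈ J.finsuppAntidiag a.2,
        ((negBinom q a.1 * ∏ j ∈ J, negBinom (p j) (l j) : ℚ) : ℂ) *
          (1 / ((m : ℂ) + 1 / 2) ^ (q + a.1) *
            ∏ j ∈ J, (biZeta (p j + l j) (xs j) (m + N) - biZeta (p j + l j) (xs j) m)) := by
  rw [lowCoeff, PowerSeries.coeff_mul]
  refine Finset.sum_congr rfl fun a _ => ?_
  rw [PowerSeries.coeff_prod, coeff_powSeries, Finset.mul_sum]
  refine Finset.sum_congr rfl fun l _ => ?_
  simp only [coeff_regPart, Finset.prod_mul_distrib]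
  push_cast
  ring

/-- Taking the coefficient of degree `e` distributes `e` over the exponents `q` and `p_j`, with
rational binomial coefficients. Larger exponents still avoid the pair `(1, 1)`, so each piece is a
sum of order `J.card < r` already treated. -/
lemma limMem_lowCoeff (hr : 1 ≤ r) (J : Finset (Fin r)) (hJ : J.card < r) {p : Fin r → ℕ}
    {q : ℕ} (hp : ∀ j, 1 ≤ p j) (hq : 1 ≤ q) (hxs : ∀ j, IsOfFinOrder (xs j))
    (hx : IsOfFinOrder x) (hpx : ∀ j, (p j, xs j) ≠ (1, 1)) (hqx : (q, x) ≠ (1, 1)) (e : ℕ) :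
    LimMem xs x fun N => ∑ n ∈ Finset.range N,
      x ^ (Int.negSucc n) * lowCoeff N p q xs J e (Int.negSucc n) := by
  have h : LimMem xs x fun N => ∑ a ∈ Finset.HasAntidiagonal.antidiagonal e,
      ∑ l ∈ J.finsuppAntidiag a.2,
        ((negBinom q a.1 * ∏ j ∈ J, negBinom (p j) (l j) : ℚ) : ℂ) *
          ∑ n ∈ Finset.range N,
            x ^ (Int.negSucc n) / (((Int.negSucc n : ℤ) : ℂ) + 1 / 2) ^ (q + a.1) *
            ∏ j ∈ J, (biZeta (p j + l j) (xs j) (Int.negSucc n + N)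
              - biZeta (p j + l j) (xs j) (Int.negSucc n)) := by
    refine LimMem.sum _ fun a _ => LimMem.sum _ fun l _ => LimMem.ratCast_mul _ ?_
    exact limMem_negSucc_diff hr J hJ (p := fun j => p j + l j) (fun j => by have := hp j; omega)
      (by omega) hxs hx (fun j => add_ne_pair (hp j) (hpx j) _) (add_ne_pair hq hqx _)
  refine h.congr fun N => ?_
  simp only [lowCoeff_eq, Finset.mul_sum]
  refine (Finset.sum_congr rfl fun a _ => Finset.sum_comm).trans ?_
  rw [Finset.sum_comm]
  refine Finset.sum_congr rfl fun n _ => Finset.sum_congr rfl fun a _ =>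
    Finset.sum_congr rfl fun l _ => ?_
  ring

/-! ### Bilateral zeta values -/

lemma biZeta_tendsto_atTop {i : ℕ} {y : ℂ} (hi : 1 ≤ i) (hy : ‖y‖ = 1) (h : (i, y) ≠ (1, 1)) :
    Tendsto (biZeta i y) atTop (𝓝 (polylog i y)) := by
  have ht : Tendsto Int.toNat atTop atTop :=
    tendsto_atTop.mpr fun n => by
      filter_upwards [eventually_ge_atTop (n : ℤ)] with m hm
      omega
  refine ((zetaFin_tendsto hi hy h).comp ht).congr' ?_
  filter_upwards [eventually_ge_atTop (0 : ℤ)] with m hm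
  obtain ⟨n, rfl⟩ := Int.eq_ofNat_of_zero_le hm
  rfl

lemma biZeta_tendsto_atBot {i : ℕ} {y : ℂ} (hi : 1 ≤ i) (hy : ‖y‖ = 1) (h : (i, y) ≠ (1, 1)) :
    Tendsto (biZeta i y) atBot (𝓝 ((-1) ^ (i + 1) * polylog i y⁻¹)) := by
  have ht : Tendsto (fun m : ℤ => (-m - 1).toNat) atBot atTop :=
    tendsto_atTop.mpr fun n => by
      filter_upwards [eventually_le_atBot (-(n : ℤ) - 1)] with m hm
      omega
  refine (((zetaFin_tendsto (x := y⁻¹) hi (by simp [hy]) (inv_ne_pair h)).const_mul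
    ((-1) ^ (i + 1))).comp ht).congr' ?_
  filter_upwards [eventually_lt_atBot (0 : ℤ)] with m hm
  obtain ⟨n, rfl⟩ := Int.eq_negSucc_of_lt_zero hm
  have : (-Int.negSucc n - 1).toNat = n := by omega
  simp only [Function.comp_apply, this, biZeta_negSucc]

lemma tendsto_natCast_add_int (k : ℤ) : Tendsto (fun M : ℕ => (M : ℤ) + k) atTop atTop :=
  tendsto_atTop_add_const_right _ _ tendsto_natCast_atTop_atTop

/-- For the pair `(1, 1)` the values are harmonic numbers and diverge, but a bounded shift changes
them by a bounded number of terms tending to `0`. -/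
lemma biZeta_one_one_shift (k : ℤ) :
    Tendsto (fun M : ℕ => biZeta 1 1 (M + k) - biZeta 1 1 M) atTop (𝓝 0) := by
  have hinc : ∀ k : ℤ, Tendsto (fun M : ℕ => biZeta 1 1 (M + k + 1) - biZeta 1 1 (M + k))
      atTop (𝓝 0) := by
    intro k
    have h0 : Tendsto (fun M : ℕ => 1 / ((M + (k + 1) : ℤ) : ℂ)) atTop (𝓝 0) := by
      simp only [one_div]
      refine tendsto_inv₀_cobounded.comp ?_
      rw [← tendsto_norm_atTop_iff_cobounded]
      simp only [Complex.norm_intCast]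
      exact tendsto_abs_atTop_atTop.comp
        (tendsto_intCast_atTop_atTop.comp (tendsto_natCast_add_int (k + 1)))
    refine h0.congr fun M => ?_
    rw [biZeta_add_one le_rfl, one_zpow, pow_one, add_sub_cancel_left, add_assoc]
  induction k using Int.induction_on with
  | zero => simp
  | succ k ih =>
    refine (by simpa using (hinc k).add ih : Tendsto _ _ _).congr fun M => ?_
    rw [← add_assoc]
  | pred k ih =>
    refine (by simpa using ih.sub (hinc (-k - 1)) : Tendsto _ _ _).congr fun M => ?_
    rw [add_assoc, sub_add_cancel]
    ring

lemma biZeta_one_one_negSucc (n : ℕ) : biZeta 1 1 (Int.negSucc n) = biZeta 1 1 n := by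
  rw [biZeta_negSucc, biZeta_natCast, inv_one]
  norm_num

/-- By `biSum_zpow_div` the shift `b` enters only through `y^b` and the ends of the window, so `c`
is the difference of the two end values of `biZeta`. For `(i, y) = (1, 1)` these diverge, but the
symmetry `biZeta_one_one_negSucc` makes them cancel and `c = 0`. -/
lemma exists_bilateral_limit (hr : 1 ≤ r) {i : ℕ} {y : ℂ} (hi : 1 ≤ i) (hy : IsOfFinOrder y) :
    ∃ c ∈ lowerCombinations xs x, ∀ b : ℤ,
      Tendsto (fun M => biSum (fun m => y ^ m / ((m : ℂ) - b) ^ i) M) atTop (𝓝 (y ^ b * c)) := by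
  have hy1 := hy.norm_eq_one
  have hy0 : y ≠ 0 := norm_ne_zero_iff.mp (by rw [hy1]; exact one_ne_zero)
  simp only [biSum_zpow_div hi hy0]
  by_cases h : (i, y) = (1, 1)
  · obtain ⟨rfl, rfl⟩ := Prod.mk.injEq _ _ _ _ ▸ h
    refine ⟨0, Submodule.zero_mem _, fun b => Tendsto.const_mul _ ?_⟩
    have := (biZeta_one_one_shift (-1 - b)).sub (biZeta_one_one_shift b)
    rw [sub_zero] at this
    refine this.congr' ?_
    filter_upwards [eventually_ge_atTop b.natAbs] with M hM
    obtain ⟨n, hn⟩ : ∃ n : ℕ, (M : ℤ) + b = n := Int.eq_ofNat_of_zero_le (by omega)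
    rw [sub_sub_sub_cancel_right, hn, ← biZeta_one_one_negSucc]
    congr 2 <;> omega
  · refine ⟨polylog i y - (-1) ^ (i + 1) * polylog i y⁻¹, Submodule.sub_mem _
      (polylog_mem hr hi hy h) ?_, fun b => Tendsto.const_mul _ (Tendsto.sub ?_ ?_)⟩
    · have := ratCast_mul_mem_lowerCombinations (xs := xs) (x := x) ((-1) ^ (i + 1))
        (polylog_mem hr hi (isOfFinOrder_inv hy) (inv_ne_pair h))
      push_cast at this
      exact this
    · refine (biZeta_tendsto_atTop hi hy1 h).comp ?_
      refine (tendsto_natCast_add_int (-1 - b)).congr fun M => by ring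
    · refine (biZeta_tendsto_atBot hi hy1 h).comp ?_
      refine (tendsto_neg_atTop_atBot.comp (tendsto_natCast_add_int (1 + b))).congr fun M => ?_
      simp only [Function.comp_apply]
      ring

lemma limMem_halfSum (hr : 1 ≤ r) {i : ℕ} {y : ℂ} (hi : 1 ≤ i) (hy : IsOfFinOrder y)
    (h : (i, y) ≠ (1, 1)) :
    LimMem xs x fun N => ∑ n ∈ Finset.range N, y ^ n / ((n : ℂ) + 1 / 2) ^ i := by
  -- The index set is empty; the exponents `2` and arguments `1` are placeholders satisfying the
  -- side conditions.
  refine (limMem_halfEuler (∅ : Finset (Fin r)) (by rw [Finset.card_empty]; omega) (p := fun _ => 2)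
    (ys := fun _ => 1) (fun _ => by norm_num) hi (fun _ => IsOfFinOrder.one) hy
    (fun _ => by simp) h).congr fun N => Finset.sum_congr rfl fun n _ => ?_
  rw [Finset.prod_empty]
  ring

lemma limMem_bilateral_half (hx : x ≠ 0) (hxs : ∀ j, xs j ≠ 0) (hr : 1 ≤ r) {i : ℕ} (hi : 1 ≤ i)
    {y : ℂ} (hy : IsOfFinOrder y) (hm : y⁻¹ ∈ rootMonomials xs x) :
    LimMem xs x fun M => biSum (fun m => y ^ m / ((m : ℂ) + 1 / 2) ^ i) M := by
  simp only [biSum, zpow_negSucc_div]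
  by_cases h : (i, y) = (1, 1)
  · obtain ⟨rfl, rfl⟩ := Prod.mk.injEq _ _ _ _ ▸ h
    -- For `(i, y) = (1, 1)` the terms at `n` and `-n - 1` are opposite, so the symmetric sums
    -- vanish identically.
    refine LimMem.zero.congr fun M => (Finset.sum_eq_zero fun n _ => ?_).symm
    simp
  · refine ((limMem_halfSum hr hi hy h).add (((limMem_halfSum hr hi (isOfFinOrder_inv hy)
      (inv_ne_pair h)).neg_one_pow_mul i).monomial_mul hx hxs hm)).congr fun N => ?_
    rw [Finset.mul_sum, Finset.mul_sum, ← Finset.sum_add_distrib]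
    simp

lemma limMem_mul_coeff_halfPart (hr : 1 ≤ r) {p : Fin r → ℕ} (hp : ∀ j, 1 ≤ p j)
    (hxs : ∀ j, IsOfFinOrder (xs j)) (hx : x ≠ 0) (hpx : ∀ j, (p j, xs j) ≠ (1, 1))
    {d : ℂ} (hd : d ∈ lowerCombinations xs x) (e : ℕ) :
    LimMem xs x fun N => d * PowerSeries.coeff e (∏ j, halfPart N (p j) (xs j)) := by
  have hxs0 : ∀ j, xs j ≠ 0 := fun j =>
    norm_ne_zero_iff.mp (by rw [(hxs j).norm_eq_one]; exact one_ne_zero)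
  simp only [PowerSeries.coeff_prod, Finset.mul_sum]
  refine LimMem.sum _ fun l _ => (LimMem.const hd).mul_prod hx hxs0 _ fun j _ => ?_
  simp only [halfPart, PowerSeries.coeff_mk]
  refine LimMem.ratCast_mul _ (LimMem.monomial_mul hx hxs0
    ⟨0, Pi.single j 1, ?_⟩ (limMem_halfSum hr (by have := hp j; omega) (hxs j)
      (add_ne_pair (hp j) (hpx j) _)))
  rw [zpow_zero, one_mul, Finset.prod_eq_single_of_mem j (Finset.mem_univ j)]
  · simp
  · intro k _ hk
    simp [Pi.single_eq_of_ne hk]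

end Module

/-! ### The parity relation -/

lemma biSum_add (F G : ℤ → ℂ) (M : ℕ) : biSum (fun m => F m + G m) M = biSum F M + biSum G M := by
  simp only [biSum, ← Finset.sum_add_distrib]
  exact Finset.sum_congr rfl fun _ _ => by ring

lemma biSum_const_mul (c : ℂ) (F : ℤ → ℂ) (M : ℕ) :
    biSum (fun m => c * F m) M = c * biSum F M := by
  simp only [biSum, Finset.mul_sum, mul_add]

lemma biSum_sum {α : Type*} (s : Finset α) (F : α → ℤ → ℂ) (M : ℕ) :
    biSum (fun m => ∑ a ∈ s, F a m) M = ∑ a ∈ s, biSum (F a) M := by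
  simp only [biSum, ← Finset.sum_add_distrib]
  exact Finset.sum_comm

lemma biSum_ite_neg (F : ℤ → ℂ) {N M : ℕ} (h : N ≤ M) :
    biSum (fun m => if -(N : ℤ) ≤ m ∧ m < 0 then F m else 0) M
      = ∑ n ∈ Finset.range N, F (Int.negSucc n) := by
  rw [biSum]
  symm
  refine (Finset.sum_congr rfl fun n hn => ?_).trans
    (Finset.sum_subset (Finset.range_mono h) fun n _ hn => ?_)
  · have := Finset.mem_range.mp hn
    rw [if_neg (by omega), if_pos (by omega), zero_add]
  · rw [Finset.mem_range] at hn
    rw [if_neg (by omega), if_neg (by omega), zero_add]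

section Identity

variable {ι : Type*} [Fintype ι] [DecidableEq ι] {p : ι → ℕ} {q : ℕ} {xs : ι → ℂ} {x : ℂ}

lemma zpow_mul_coeff_zero_truncKernel (hp : ∀ j, 1 ≤ p j) (hxs : ∀ j, xs j ≠ 0) (N : ℕ) (m : ℤ) :
    (x * ∏ j, xs j) ^ m * (truncKernel N p q xs m).coeff 0
      = x ^ m / ((m : ℂ) + 1 / 2) ^ q * ∏ j, (biZeta (p j) (xs j) (m + N) - biZeta (p j) (xs j) m)
        + if -(N : ℤ) ≤ m ∧ m < 0 then ∑ J ∈ Finset.univ.erase (Finset.univ : Finset ι),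
            x ^ m * lowCoeff N p q xs J (∑ j ∈ Finset.univ \ J, p j) m else 0 := by
  split_ifs with hm
  · have h := coeff_zpow_smul_truncKernel_of_neg (x := x) (q := q) hp hxs N hm 0
    rw [Nat.cast_zero, neg_zero] at h
    rw [h, ← Finset.add_sum_erase _ _ (Finset.mem_univ (Finset.univ : Finset ι)), mul_add,
      Finset.sdiff_self, Finset.sum_empty, if_pos le_rfl, Nat.sub_zero, lowCoeff_zero, Finset.mul_sum]
    simp only [Nat.zero_le, if_true, Nat.sub_zero]
    ring
  · rw [← smul_eq_mul, ← HahnSeries.coeff_smul, zpow_smul_truncKernel hp hxs,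
      HahnSeries.coeff_smul, smul_eq_mul]
    simp only [if_neg hm, add_zero]
    rw [← map_prod, ← map_mul, PowerSeries.coeff_coe, if_neg (lt_irrefl (0 : ℤ)), Int.natAbs_zero]
    have := lowCoeff_zero p q xs Finset.univ N m
    rw [lowCoeff] at this
    rw [this]
    ring

/-- The constant coefficients of the kernel are computed twice, locally by Laurent expansion and
globally by partial fractions. The condition `N ≤ M` puts all integer poles `-N, …, -1` inside the
window, so the whole correction is collected. -/
lemma biSum_truncated (hp : ∀ j, 1 ≤ p j) (hq : 1 ≤ q) (hxs : ∀ j, xs j ≠ 0) {N M : ℕ}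
    (h : N ≤ M) :
    biSum (fun m => x ^ m / ((m : ℂ) + 1 / 2) ^ q *
        ∏ j, (biZeta (p j) (xs j) (m + N) - biZeta (p j) (xs j) m)) M
      = ∑ i ∈ Finset.Icc 1 (q + ∑ j, p j), (truncKernel N p q xs (-(1 / 2))).coeff (-(i : ℤ)) *
          biSum (fun m => (x * ∏ j, xs j) ^ m / ((m : ℂ) + 1 / 2) ^ i) M
        + ∑ n ∈ Finset.range N, ∑ i ∈ Finset.Icc 1 (q + ∑ j, p j),
          (truncKernel N p q xs (Int.negSucc n : ℤ)).coeff (-(i : ℤ)) *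
          biSum (fun m => (x * ∏ j, xs j) ^ m / ((m : ℂ) - (Int.negSucc n : ℤ)) ^ i) M
        - ∑ n ∈ Finset.range N, ∑ J ∈ Finset.univ.erase (Finset.univ : Finset ι),
            x ^ (Int.negSucc n) *
              lowCoeff N p q xs J (∑ j ∈ Finset.univ \ J, p j) (Int.negSucc n) := by
  rw [eq_sub_iff_add_eq, ← biSum_ite_neg (fun m => ∑ J ∈ Finset.univ.erase
    (Finset.univ : Finset ι), x ^ m * lowCoeff N p q xs J (∑ j ∈ Finset.univ \ J, p j) m) h,
    ← biSum_add]
  simp only [← zpow_mul_coeff_zero_truncKernel hp hxs, ← biSum_const_mul, ← biSum_sum]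
  rw [← biSum_add]
  congr 1
  funext m
  rw [coeff_zero_truncKernel hp hq, mul_add, Finset.mul_sum, Finset.mul_sum]
  congr 1
  · exact Finset.sum_congr rfl fun i _ => by ring
  · refine Finset.sum_congr rfl fun n _ => ?_
    rw [Finset.mul_sum]
    exact Finset.sum_congr rfl fun i _ => by ring

end Identity

lemma isOfFinOrder_mul_prod {ι : Type*} [Fintype ι] {xs : ι → ℂ} {x : ℂ}
    (hxs : ∀ j, IsOfFinOrder (xs j)) (hx : IsOfFinOrder x) : IsOfFinOrder (x * ∏ j, xs j) := by
  refine (Commute.all _ _).isOfFinOrder_mul hx ?_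
  exact Finset.prod_induction xs IsOfFinOrder (fun a b ha hb => (Commute.all a b).isOfFinOrder_mul
    ha hb) IsOfFinOrder.one fun j _ => hxs j

section Parity

variable {r : ℕ} {p : Fin r → ℕ} {q : ℕ} {xs : Fin r → ℂ} {x : ℂ}

/-- The bilateral sum of the shifted product is a lower combination. -/
lemma limMem_bilateral (hr : 1 ≤ r) (hp : ∀ j, 1 ≤ p j) (hq : 1 ≤ q)
    (hxs : ∀ j, IsOfFinOrder (xs j)) (hx : IsOfFinOrder x) (hpx : ∀ j, (p j, xs j) ≠ (1, 1))
    (hqx : (q, x) ≠ (1, 1)) :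
    LimMem xs x (biSum fun m => x ^ m / ((m : ℂ) + 1 / 2) ^ q *
      ∏ j, (polylog (p j) (xs j) - biZeta (p j) (xs j) m)) := by
  have hx0 : x ≠ 0 := norm_ne_zero_iff.mp (by rw [hx.norm_eq_one]; exact one_ne_zero)
  have hxs0 : ∀ j, xs j ≠ 0 := fun j =>
    norm_ne_zero_iff.mp (by rw [(hxs j).norm_eq_one]; exact one_ne_zero)
  set y := x * ∏ j, xs j with hydef
  set D := q + ∑ j, p j
  have hy : IsOfFinOrder y := isOfFinOrder_mul_prod hxs hx
  have hyinv : y⁻¹ ∈ rootMonomials xs x := by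
    rw [← zpow_neg_one]; exact zpow_mul_prod_mem_rootMonomials (-1)
  have hc : ∀ i : ℕ, ∃ c ∈ lowerCombinations xs x, 1 ≤ i → ∀ b : ℤ,
      Tendsto (fun M => biSum (fun m => y ^ m / ((m : ℂ) - b) ^ i) M) atTop (𝓝 (y ^ b * c)) := by
    intro i
    by_cases hi : 1 ≤ i
    · obtain ⟨c, hc, h⟩ := exists_bilateral_limit (xs := xs) (x := x) hr hi hy
      exact ⟨c, hc, fun _ => h⟩
    · exact ⟨0, Submodule.zero_mem _, fun h => absurd h hi⟩
  have hd : ∀ i : ℕ, ∃ d ∈ lowerCombinations xs x, 1 ≤ i →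
      Tendsto (fun M => biSum (fun m => y ^ m / ((m : ℂ) + 1 / 2) ^ i) M) atTop (𝓝 d) := by
    intro i
    by_cases hi : 1 ≤ i
    · obtain ⟨d, hd, h⟩ := limMem_bilateral_half hx0 hxs0 hr hi hy hyinv
      exact ⟨d, hd, fun _ => h⟩
    · exact ⟨0, Submodule.zero_mem _, fun h => absurd h hi⟩
  choose c hcmem hc using hc
  choose d hdmem hd using hd
  set S := Finset.univ.erase (Finset.univ : Finset (Fin r))
  have hcard : ∀ J ∈ S, J.card < r := fun J hJ => by
    have := (Finset.card_lt_iff_ne_univ J).mpr (Finset.ne_of_mem_erase hJ)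
    rwa [Fintype.card_fin] at this
  -- `I N` is the limit, for fixed `N` and `M → ∞`, of the right side of `biSum_truncated`.
  obtain ⟨I, hI⟩ : ∃ I : ℕ → ℂ, I = fun N =>
    ∑ i ∈ Finset.Icc 1 D, (truncKernel N p q xs (-(1 / 2))).coeff (-(i : ℤ)) * d i
      + ∑ n ∈ Finset.range N, ∑ i ∈ Finset.Icc 1 D,
          (truncKernel N p q xs (Int.negSucc n : ℤ)).coeff (-(i : ℤ)) *
            (y ^ (Int.negSucc n) * c i)
      - ∑ n ∈ Finset.range N, ∑ J ∈ S, x ^ (Int.negSucc n) *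
          lowCoeff N p q xs J (∑ j ∈ Finset.univ \ J, p j) (Int.negSucc n) := ⟨_, rfl⟩
  have hlim : ∀ N : ℕ, Tendsto (fun M => biSum (fun m => x ^ m / ((m : ℂ) + 1 / 2) ^ q *
      ∏ j, (biZeta (p j) (xs j) (m + N) - biZeta (p j) (xs j) m)) M) atTop (𝓝 (I N)) := by
    intro N
    have h : Tendsto (fun M => ∑ i ∈ Finset.Icc 1 D,
          (truncKernel N p q xs (-(1 / 2))).coeff (-(i : ℤ)) *
            biSum (fun m => y ^ m / ((m : ℂ) + 1 / 2) ^ i) M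
        + ∑ n ∈ Finset.range N, ∑ i ∈ Finset.Icc 1 D,
          (truncKernel N p q xs (Int.negSucc n : ℤ)).coeff (-(i : ℤ)) *
            biSum (fun m => y ^ m / ((m : ℂ) - (Int.negSucc n : ℤ)) ^ i) M
        - ∑ n ∈ Finset.range N, ∑ J ∈ S, x ^ (Int.negSucc n) *
          lowCoeff N p q xs J (∑ j ∈ Finset.univ \ J, p j) (Int.negSucc n)) atTop (𝓝 (I N)) := by
      rw [hI]
      refine ((tendsto_finsetSum _ fun i hi => ?_).add (tendsto_finsetSum _ fun n _ =>
        tendsto_finsetSum _ fun i hi => ?_)).sub_const _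
      · exact (hd i (Finset.mem_Icc.mp hi).1).const_mul _
      · exact (hc i (Finset.mem_Icc.mp hi).1 _).const_mul _
    refine h.congr' ?_
    filter_upwards [eventually_ge_atTop N] with M hM
    exact (biSum_truncated hp hq hxs0 hM).symm
  have hlow : ∀ J ∈ S, ∀ e, LimMem xs x fun N => ∑ n ∈ Finset.range N,
      x ^ (Int.negSucc n) * lowCoeff N p q xs J e (Int.negSucc n) := fun J hJ e =>
    limMem_lowCoeff hr J (hcard J hJ) hp hq hxs hx hpx hqx e
  have hImem : LimMem xs x I := by
    rw [hI]
    refine (LimMem.add ?_ ?_).sub ?_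
    · refine LimMem.sum _ fun i _ => ?_
      simp only [coeff_truncKernel_neg_half]
      split_ifs
      · exact (limMem_mul_coeff_halfPart hr hp hxs hx0 hpx (hdmem i) (q - i)).congr
          fun N => mul_comm _ _
      · simpa using LimMem.zero
    · have h : LimMem xs x fun N => ∑ i ∈ Finset.Icc 1 D, ∑ J ∈ S, c i * ∑ n ∈ Finset.range N,
          if i ≤ ∑ j ∈ Finset.univ \ J, p j then x ^ (Int.negSucc n) *
            lowCoeff N p q xs J (∑ j ∈ Finset.univ \ J, p j - i) (Int.negSucc n) else 0 := by
        refine LimMem.sum _ fun i _ => LimMem.sum _ fun J hJ =>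
          (LimMem.const (hcmem i)).mul hx0 hxs0 ?_
        split_ifs
        · exact hlow J hJ _
        · simpa using LimMem.zero
      refine h.congr fun N => ?_
      conv_rhs => rw [Finset.sum_comm]
      refine Finset.sum_congr rfl fun i hi => ?_
      simp only [Finset.mul_sum]
      rw [Finset.sum_comm]
      refine Finset.sum_congr rfl fun n hn => ?_
      have hn := Finset.mem_range.mp hn
      have hi := (Finset.mem_Icc.mp hi).1
      -- The factor `y^(-n-1)` supplied by the bilateral limit combines with the polar coefficient
      -- at `-n - 1`; since `i ≥ 1`, the contribution of `J = univ` vanishes.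
      have key := coeff_zpow_smul_truncKernel_of_neg (x := x) (q := q) hp hxs0 N
        (m := Int.negSucc n) (by omega) i
      rw [← hydef, ← Finset.add_sum_erase _ _ (Finset.mem_univ (Finset.univ : Finset (Fin r))),
        Finset.sdiff_self, Finset.sum_empty, if_neg (by omega), zero_add] at key
      rw [← mul_assoc, mul_comm _ (c i), mul_comm _ (y ^ _), key,
        Finset.mul_sum, Finset.mul_sum]
      refine Finset.sum_congr rfl fun J _ => ?_
      split_ifs
      · rfl
      · simp
    · refine (LimMem.sum S fun J hJ => hlow J hJ (∑ j ∈ Finset.univ \ J, p j)).congr fun N => ?_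
      exact Finset.sum_comm
  obtain ⟨K, hK⟩ := truncation_error_main (J := (Finset.univ : Finset (Fin r)))
    ⟨⟨0, hr⟩, Finset.mem_univ _⟩ (fun j _ => hp j) hq (fun j _ => (hxs j).norm_eq_one)
    hx.norm_eq_one (fun j _ => hpx j)
  have herr : Tendsto (fun N => biSum (fun m => x ^ m / ((m : ℂ) + 1 / 2) ^ q *
      ∏ j, (polylog (p j) (xs j) - biZeta (p j) (xs j) m)) N - I N) atTop (𝓝 0) := by
    have ht : Tendsto (fun N : ℕ => K / √(N : ℝ)) atTop (𝓝 0) :=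
      (Real.tendsto_sqrt_atTop.comp tendsto_natCast_atTop_atTop).const_div_atTop K
    refine squeeze_zero_norm' ?_ ht
    filter_upwards [eventually_ge_atTop 1] with N hN
    rw [norm_sub_rev]
    -- The bound of `truncation_error_main` is uniform in `M ≥ N` and so survives `M → ∞`.
    refine le_of_tendsto ((hlim N).sub_const _).norm ?_
    filter_upwards [eventually_ge_atTop N] with M hM using hK N hN M hM
  exact (hImem.add_tendsto_zero herr).congr fun N => add_sub_cancel _ _

lemma limMem_parity (hr : 1 ≤ r) (hp : ∀ j, 1 ≤ p j) (hq : 1 ≤ q)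
    (hxs : ∀ j, IsOfFinOrder (xs j)) (hx : IsOfFinOrder x) (hpx : ∀ j, (p j, xs j) ≠ (1, 1))
    (hqx : (q, x) ≠ (1, 1)) :
    LimMem xs x fun N => x * partialR p q xs x N + (-1) ^ ((∑ j, p j) + q + r) *
      partialR p q (fun j => (xs j)⁻¹) x⁻¹ N := by
  have hx0 : x ≠ 0 := norm_ne_zero_iff.mp (by rw [hx.norm_eq_one]; exact one_ne_zero)
  have hxs0 : ∀ j, xs j ≠ 0 := fun j =>
    norm_ne_zero_iff.mp (by rw [(hxs j).norm_eq_one]; exact one_ne_zero)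
  have hpos := limMem_affine_sub hx0 hxs0 Finset.univ hp hq hxs hx hpx hqx
    (a := fun j => polylog (p j) (xs j)) (fun j => polylog_mem hr (hp j) (hxs j) (hpx j))
    (fun _ => -1)
  have hneg := limMem_affine_sub hx0 hxs0 Finset.univ (ys := fun j => (xs j)⁻¹) (y := x⁻¹) hp hq
    (fun j => isOfFinOrder_inv (hxs j)) (isOfFinOrder_inv hx) (fun j => inv_ne_pair (hpx j))
    (inv_ne_pair hqx) (a := fun j => polylog (p j) (xs j))
    (fun j => polylog_mem hr (hp j) (hxs j) (hpx j)) (fun j => -(-1) ^ (p j + 1))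
  have hbi := limMem_bilateral hr hp hq hxs hx hpx hqx
  -- Subtracting the non-leading terms on both half-lines leaves `(-1)^r` times the partial sum at
  -- `x`, plus `x⁻¹ (-1)^(∑ p_j + q)` times the one at the inverse arguments. Multiplication by
  -- `(-1)^r x` gives the asserted combination.
  have h := ((hbi.sub hpos).sub ((hneg.neg_one_pow_mul q).monomial_mul hx0 hxs0
    (zpow_mem_rootMonomials (-1)))).neg_one_pow_mul r
  refine (h.monomial_mul hx0 hxs0 (zpow_mem_rootMonomials 1)).congr fun N => ?_
  have hs1 : ∀ n, ∏ j, ((-1 : ℚ) : ℂ) * zetaFin n (p j) (xs j)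
      = (-1) ^ r * ∏ j, zetaFin n (p j) (xs j) := fun n => by
    rw [Finset.prod_mul_distrib]
    simp
  have hs2 : ∀ n, ∏ j, ((-(-1) ^ (p j + 1) : ℚ) : ℂ) * zetaFin n (p j) (xs j)⁻¹
      = (-1) ^ (∑ j, p j) * ∏ j, zetaFin n (p j) (xs j)⁻¹ := fun n => by
    rw [Finset.prod_mul_distrib, ← Finset.prod_pow_eq_pow_sum]
    congr 1
    refine Finset.prod_congr rfl fun j _ => ?_
    push_cast
    ring
  have hterm : ∀ n : ℕ, ∀ j, ((-1 : ℚ) : ℂ) * zetaFin n (p j) (xs j) + polylog (p j) (xs j)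
      = polylog (p j) (xs j) - biZeta (p j) (xs j) n := fun n j => by
    rw [biZeta_natCast]; push_cast; ring
  have hterm' : ∀ n : ℕ, ∀ j, ((-(-1) ^ (p j + 1) : ℚ) : ℂ) * zetaFin n (p j) (xs j)⁻¹
      + polylog (p j) (xs j)
      = polylog (p j) (xs j) - biZeta (p j) (xs j) (Int.negSucc n) := fun n j => by
    rw [biZeta_negSucc]; push_cast; ring
  simp only [hs1, hs2, hterm, hterm']
  rw [zpow_one, zpow_neg_one, biSum, partialR, partialR]
  simp only [zpow_negSucc_div, zpow_natCast, Int.cast_natCast]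
  have hr2 : ((-1 : ℂ) ^ r) * (-1) ^ r = 1 := by rw [← mul_pow]; simp
  have hxx : x * x⁻¹ = 1 := mul_inv_cancel₀ hx0
  simp only [Finset.mul_sum, ← Finset.sum_sub_distrib, ← Finset.sum_add_distrib]
  refine Finset.sum_congr rfl fun n _ => ?_
  set P := ∏ j, zetaFin n (p j) (xs j)
  set P' := ∏ j, zetaFin n (p j) (xs j)⁻¹
  set Q := ∏ j, (polylog (p j) (xs j) - biZeta (p j) (xs j) n)
  set Q' := ∏ j, (polylog (p j) (xs j) - biZeta (p j) (xs j) (Int.negSucc n))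
  rw [pow_add, pow_add]
  linear_combination (x * P / ((n : ℂ) + 1 / 2) ^ q * x ^ n) * hr2
    + ((-1) ^ r * (-1) ^ q * (-1) ^ (∑ j, p j) * P' / ((n : ℂ) + 1 / 2) ^ q * x⁻¹ ^ n) * hxx

lemma partialR_tendsto_eulerR (hp : ∀ j, 1 ≤ p j) (hq : 1 ≤ q)
    (hxs : ∀ j, IsOfFinOrder (xs j)) (hx : IsOfFinOrder x) (hpx : ∀ j, (p j, xs j) ≠ (1, 1))
    (hqx : (q, x) ≠ (1, 1)) : Tendsto (partialR p q xs x) atTop (𝓝 (eulerR p q xs x)) :=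
  tendsto_nhds_limUnder (halfEuler_converges Finset.univ (fun j _ => hp j) hq
    (fun j _ => (hxs j).norm_eq_one) hx.norm_eq_one (fun j _ => hpx j) hqx)

end Parity

end CyclotomicEuler

end

theorem theorem1p1 (r : ℕ) (hr : 1 ≤ r) (p : Fin r → ℕ) (q : ℕ) (xs : Fin r → ℂ) (x : ℂ)
    (hp : ∀ j, 1 ≤ p j) (hq : 1 ≤ q)
    (hxs : ∀ j, IsOfFinOrder (xs j)) (hx : IsOfFinOrder x)
    (hpx : ∀ j, (p j, xs j) ≠ (1, 1)) (hqx : (q, x) ≠ (1, 1)) :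
    Tendsto (CyclotomicEuler.partialR p q xs x) atTop (𝓝 (CyclotomicEuler.eulerR p q xs x)) ∧
    Tendsto (CyclotomicEuler.partialR p q (fun j => (xs j)⁻¹) x⁻¹) atTop
      (𝓝 (CyclotomicEuler.eulerR p q (fun j => (xs j)⁻¹) x⁻¹)) ∧
    x * CyclotomicEuler.eulerR p q xs x
        + (-1 : ℂ) ^ ((∑ j, p j) + q + r)
          * CyclotomicEuler.eulerR p q (fun j => (xs j)⁻¹) x⁻¹
      ∈ CyclotomicEuler.lowerCombinations xs x := by
  have h1 := CyclotomicEuler.partialR_tendsto_eulerR hp hq hxs hx hpx hqx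
  have h2 := CyclotomicEuler.partialR_tendsto_eulerR (xs := fun j => (xs j)⁻¹) (x := x⁻¹) hp hq
    (fun j => CyclotomicEuler.isOfFinOrder_inv (hxs j)) (CyclotomicEuler.isOfFinOrder_inv hx)
    (fun j => CyclotomicEuler.inv_ne_pair (hpx j))
    (CyclotomicEuler.inv_ne_pair hqx)
  refine ⟨h1, h2, ?_⟩
  obtain ⟨v, hv, hlim⟩ := CyclotomicEuler.limMem_parity hr hp hq hxs hx hpx hqx
  rwa [tendsto_nhds_unique ((h1.const_mul x).add (h2.const_mul _)) hlim]
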